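/- **Problem.** Let $E,I,V$ be finite index sets and let $f,h_i\,(i\in E),g_i\,(i\in I),G_i,H_i\,(i\in V)$ be continuously differentiable functions on $\mathbb R^n$. Consider the mathematical program with vanishing constraints $$\min f(x)\quad\text{s.t. } h_i(x)=0\ (i\in E),\ g_i(x)\le 0\ (i\in I),\ H_i(x)\ge 0,\ G_i(x)H_i(x)\le 0\ (i\in V).\tag{MPVC}$$ Put $I^{0+}(x)=\{i: H_i(x)=0<G_i(x)\}$, $I^{0-}(x)=\{i:H_i(x)=0>G_i(x)\}$, $I^{+0}(x)=\{i:H_i(x)>0=G_i(x)\}$, $I^{00}(x)=\{i:H_i(x)=0=G_i(x)\}$. A multiplier $\lambda=(\lambda^h,\lambda^g,\lambda^H,\lambda^G)$ is called *weak* at $x$ if $$\nabla f(x)+\sum_E\lambda^h_i\nabla h_i(x)+\sum_I\lambda^g_i\nabla g_i(x)+\sum_V\bigl(-\lambda^H_i\nabla H_i(x)+\lambda^G_i\nabla G_i(x)\bigr)=0,$$ $\lambda^g_ig_i(x)=0$, $\lambda^H_iH_i(x)=0$, $\lambda^G_iG_i(x)=0$, $\lambda^g_i\ge0$ for all $i$,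 $\lambda^H_i\ge 0$ on $I^{0-}(x)$ and $\lambda^G_i\ge0$ on $I^{00}(x)\cup I^{+0}(x)$. A feasible $x$ is *$\mathcal Q$-stationary with respect to a partition $(\beta^1,\beta^2)$ of $I^{00}(x)$* if there are weak multipliers $\overline\lambda,\underline\lambda$ with $\overline\lambda^G_i=0$, $\underline\lambda^H_i,\underline\lambda^G_i\ge0$ on $\beta^1$ and $\overline\lambda^H_i,\overline\lambda^G_i\ge0$, $\underline\lambda_i^G=0$ on $\beta^2$. It is *$\mathcal Q_M$-stationary* if, for some partition, such $\overline\lambda,\underline\lambda$ exist and at least one of them satisfies $\lambda_i^H\lambda_i^G=0$ for all $i\in I^{00}(x)$. **Notation.** $F_i=(-H_i,G_i)^T$, $P=\{(a,b):a\le 0,\ ab\ge 0\}$, $P^1=\{0\}\times\mathbb R$, $P^2=\mathbb R_-^2$ (so $P=P^1\cup P^2$), $d(u,A)=\inf_{y\in A}\|u-y\|_1$, $a^+=\max(0,a)$, $a^-=\min(0,a)$ (componentwise). **Auxiliary procedure.** Input: $\zeta\in(0,1)$, $\bar\rho>1$, $\rho>0$, a symmetric positive definite matrix $B$, numbers $h_i,g_i,G_i,H_i$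 and row vectors $\nabla f,\nabla h_i,\nabla g_i,\nabla G_i,\nabla H_i$. Put $\theta^g_i=1$ if $g_i>0$ and $0$ otherwise; $(\theta^H_i,\theta^G_i)=(0,0)$ if $d(F_i,P)=0$, $(1,0)$ if $0<d(F_i,P^1)\le d(F_i,P^2)$, and $(0,1)$ if $0<d(F_i,P^2)<d(F_i,P^1)$. Let $u_i(s,\delta)=\delta(\theta_i^HH_i,-\theta_i^GG_i)^T+F_i+\nabla F_is$. For $W\subset V$ let $QP(\rho,W)$ be: minimize $\frac12s^TBs+\nabla f s+\rho(\frac12\delta^2+\delta)$ over $(s,\delta)\in\mathbb R^{n+1}$ subject to $(1-\delta)h_i+\nabla h_is=0$, $(1-\theta_i^g\delta)g_i+\nabla g_is\le0$, $u_i(s,\delta)\in P^1$ for $i\in W$, $u_i(s,\delta)\in P^2$ for $i\in V\setminus W$, $\delta\ge0$; let $\bar\delta(W)$ be the minimal $\delta$ over its feasible set. Let $I^1(s,\delta)=\{i:u_i(s,\delta)\in P^1\setminus P^2\}$ and $I^{00}(s,\delta)=\{i:u_i(s,\delta)=0\}$. 1. Set $(s^0,\delta^0)=(0,1)$, $V_1^1=I^1(s^0,\delta^0)$;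 let $(s^1,\delta^1)$ solve $QP(\rho,V_1^1)$ with KKT multiplier $\lambda^1$; $t=1$. If $\delta^1>\delta^0$, restart: replace $\rho$ by $\rho\bar\rho$ and go to 1. 2. While $(s^t,\delta^t)$ does not solve all of $QP(\rho,W)$ for $W=I^1\cup(I^{00}\cap V_1^t)$, $I^1\cup(I^{00}\setminus V_1^t)$, $I^1$, $I^1\cup I^{00}$ (index sets at $(s^t,\delta^t)$): let $(s^{t+1},\delta^{t+1})$, $\lambda^{t+1}$ be the solution and a KKT multiplier of the first of these problems with $(s^{t+1},\delta^{t+1})\ne(s^t,\delta^t)$, let $V_1^{t+1}$ be the corresponding $W$, and increase $t$ by $1$; if now $\delta^t>\delta^{t-1}$, restart as above. 3. If $\delta^t<\zeta$, put $N=t$ and stop successfully. 4. If $\min\{\bar\delta(I^1(s^t,\delta^t)),\bar\delta(I^1(s^t,\delta^t)\cup I^{00}(s^t,\delta^t))\}<\zeta$, restart as above; otherwise stop because of degeneracy. **Extended SQP algorithm.** Constants: $\zeta,\mu,\xi\in(0,1)$, $\bar\rho>1$, $1<\xi_1<\xi_2$, $0<\underline\gamma\le\bar\gamma<1$, $0<\underline\alpha\le\bar\alpha<1$.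 Start with $x_0\in\mathbb R^n$, $\rho_0>0$ and positive penalty parameters $\sigma_{-1}=(\sigma^h_{-1},\sigma^g_{-1},\sigma^F_{-1})$; the matrices $B_k$ are symmetric positive definite. For penalty parameters $\sigma$ let $$\Phi^\sigma(x)=f(x)+\sum_E\sigma^h_i|h_i(x)|+\sum_I\sigma^g_i(g_i(x))^++\sum_V\sigma^F_i\,d(F_i(x),P),$$ and let $\varphi^\sigma_W$ be the same function with $d(F_i(x),P)$ replaced by $d(F_i(x),P^1)$ for $i\in W$ and by $d(F_i(x),P^2)$ for $i\in V\setminus W$. Let $LP(x,W)$ be: minimize $\nabla f(x)d$ subject to $\nabla h_i(x)d=0$, $(g_i(x))^-+\nabla g_i(x)d\le0$, $\nabla F_i(x)d\in P^1$ for $i\in W$, $(F_i(x))^-+\nabla F_i(x)d\in P^2$ for $i\in V\setminus W$, $-1\le d_j\le1$ for all $j$. Iteration $k$: * *Correction.* Take any $W^1_{1,k},W^2_{1,k}\subset V$, solutions $d_k^1,d_k^2$ of $LP(x_k,W^1_{1,k})$, $LP(x_k,W^2_{1,k})$, let $d_k\in\{d_k^1,d_k^2\}$ have the smaller value $\nabla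 f(x_k)d_k$ and let $W_{1,k}$ be the corresponding set. Take $\alpha_k^{(1)}=1,\alpha_k^{(2)},\dots$ with $\underline\alpha\le\alpha_k^{(j+1)}/\alpha_k^{(j)}\le\bar\alpha$. Let $\Phi_k=\Phi^{\sigma}$ and $\varphi_k=\varphi^{\sigma}_{W_{1,k}}$, where $\sigma$ is $\sigma_k$ or $\sigma_{k-1}$ (the statement holds for either choice). If $\nabla f(x_k)d_k<0$, let $j$ be the smallest index with $$\Phi_k(x_k+\alpha_k^{(j)}d_k)-\Phi_k(x_k)\le\mu\alpha_k^{(j)}\nabla f(x_k)d_k\qquad(*)$$ or $\alpha_k^{(j)}\le\frac{\Phi_k(x_k)-\varphi_k(x_k)}{\mu\nabla f(x_k)d_k}$; if it satisfies $(*)$, set $\tilde x_k=x_k+\alpha_k^{(j)}d_k$. In all other cases $\tilde x_k=x_k$. * *Auxiliary problem.* Run the auxiliary procedure with $\rho_k$, $B_k$ and the function values and gradients at $\tilde x_k$, giving $N_k$, $(s_k^t,\delta_k^t)$ ($0\le t\le N_k$), $\lambda_k^t$, $V_{1,k}^t$ ($1\le t\le N_k$); $\rho_{k+1}$ is the final $\rho$.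 The algorithm stops if this ends by degeneracy or if $s_k^{N_k}=0$. * *Penalty parameters.* With $\tilde\lambda^h_{i,k}=\max_{1\le t\le N_k}|\lambda^{h,t}_{i,k}|$, $\tilde\lambda^g_{i,k}=\max_{1\le t\le N_k}|\lambda^{g,t}_{i,k}|$, $\tilde\lambda^F_{i,k}=\max_{1\le t\le N_k}\max(|\lambda^{H,t}_{i,k}|,|\lambda^{G,t}_{i,k}|)$ set $\sigma_{i,k}=\xi_2\tilde\lambda_{i,k}$ if $\sigma_{i,k-1}<\xi_1\tilde\lambda_{i,k}$ and $\sigma_{i,k}=\sigma_{i,k-1}$ otherwise (for each of $h,g,F$). * *Next iterate.* Let $S_k^t=\sum_{\tau=1}^t\|s_k^\tau-s_k^{\tau-1}\|$; $t_k(1)=N_k$, $\alpha_k(1)=1$, and for $\gamma\in[0,1)$ let $t_k(\gamma)$ be the smallest $t$ with $S_k^t>\gamma S_k^{N_k}$ and $\alpha_k(\gamma)=\frac{\gamma S_k^{N_k}-S_k^{t_k(\gamma)-1}}{S_k^{t_k(\gamma)}-S_k^{t_k(\gamma)-1}}$. For $s=(1-\alpha)s_k^{t-1}+\alpha s_k^t$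 let $\phi_k^t(\alpha)=\varphi^{\sigma_k}_{V_{1,k}^t}(\tilde x_k+s)$, and let $\hat\phi_k^t(\alpha)$ be the expression obtained from it by replacing $f(\tilde x_k+s)$ by $f(\tilde x_k)+\nabla f(\tilde x_k)s+\frac12s^TB_ks$ and every other function value at $\tilde x_k+s$ by its linearization at $\tilde x_k$. With $t=t_k(\gamma)$, $\alpha=\alpha_k(\gamma)$ put $\hat s_k(\gamma)=s_k^{t-1}+\alpha(s_k^t-s_k^{t-1})$, $Y_k(\gamma)=\phi_k^t(\alpha)$, $Z_k(\gamma)=(1-\alpha)\hat\phi_k^t(0)+\alpha\hat\phi_k^t(1)$. Take $\gamma_1^k=1,\gamma_2^k,\dots$ with $\underline\gamma\le\gamma_{j+1}^k/\gamma_j^k\le\bar\gamma$, let $j$ be the smallest index with $Y_k(\gamma_j^k)-Y_k(0)\le\xi(Z_k(\gamma_j^k)-Z_k(0))$ and set $x_{k+1}=\tilde x_k+\hat s_k(\gamma_j^k)$. **Theorem.** Suppose the algorithm does not stop and generates infinite sequences such that (A) $\|x_k\|$, $S_k^{N_k}$ and all $\tilde\lambda^h_{i,k},\tilde\lambda^g_{i,k},\tilde\lambda^F_{i,k}$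 are bounded uniformly in $k$, the norms $\|B_k\|$ are bounded, and the smallest eigenvalues of $B_k$ are bounded below by a positive constant. Let $\bar x$ be a limit point of $(x_k)$ such that (B1) for both $W=I^{0+}(\bar x)$ and $W=I^{0+}(\bar x)\cup I^{00}(\bar x)$ the Mangasarian–Fromovitz constraint qualification holds at $\bar x$ for the system $h_i=0\ (i\in E)$, $-H_i=0\ (i\in W)$, $g_i\le0\ (i\in I)$, $-H_i\le0$, $G_i\le0\ (i\in V\setminus W)$: the gradients of the equality constraints at $\bar x$ are linearly independent, and some $d$ is orthogonal to all of them and satisfies $\nabla b(\bar x)d<0$ for every inequality constraint function $b$ of the system with $b(\bar x)=0$; (B2) there is an infinite $K\subset\mathbb N$ with $x_k\to\bar x$ for $k\to\infty$, $k\in K$, and $W^1_{1,k}=I^{0+}(\bar x)$, $W^2_{1,k}=I^{0+}(\bar x)\cup I^{00}(\bar x)$ for all $k\in K$. Then $\bar x$ is feasible for (MPVC), $\mathcal Q$-stationary with respect to $(\emptyset,I^{00}(\bar x))$, and $\mathcal Q_M$-stationary. -/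

import Mathlib

open Filter Topology

noncomputable section

namespace MPVC

/-- `ℝⁿ` with the Euclidean norm. -/
abbrev Vec (n : ℕ) := EuclideanSpace ℝ (Fin n)

/-- Row vectors in `ℝⁿ`. -/
abbrev Row (n : ℕ) := Vec n →L[ℝ] ℝ

/-! ### The program with vanishing constraints and its stationarity concepts -/

/-- `min f` subject to `h i = 0` (`i ∈ E`), `g i ≤ 0` (`i ∈ I`), `H i ≥ 0` and `G i * H i ≤ 0`
(`i ∈ V`), all functions being continuously differentiable on `ℝⁿ`. -/
structure Problem (n : ℕ) (E I V : Type*) where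
  f : Vec n → ℝ
  h : E → Vec n → ℝ
  g : I → Vec n → ℝ
  G : V → Vec n → ℝ
  H : V → Vec n → ℝ
  f_smooth : ContDiff ℝ 1 f
  h_smooth : ∀ i, ContDiff ℝ 1 (h i)
  g_smooth : ∀ i, ContDiff ℝ 1 (g i)
  G_smooth : ∀ i, ContDiff ℝ 1 (G i)
  H_smooth : ∀ i, ContDiff ℝ 1 (H i)

/-- A multiplier `(λʰ, λᵍ, λᴴ, λᴳ)`. -/
structure Mult (E I V : Type*) where
  h : E → ℝ
  g : I → ℝ
  H : V → ℝ
  G : V → ℝ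

section Stationarity

variable {n : ℕ} {E I V : Type*} (M : Problem n E I V) (x : Vec n)

def Feasible : Prop :=
  (∀ i, M.h i x = 0) ∧ (∀ i, M.g i x ≤ 0) ∧ (∀ i, 0 ≤ M.H i x ∧ M.G i x * M.H i x ≤ 0)

/-- `I⁰⁺(x)` -/
def I0plus : Set V := {i | M.H i x = 0 ∧ 0 < M.G i x}

/-- `I⁰⁻(x)` -/
def I0minus : Set V := {i | M.H i x = 0 ∧ M.G i x < 0}

/-- `I⁺⁰(x)` -/
def Iplus0 : Set V := {i | 0 < M.H i x ∧ M.G i x = 0}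

/-- `I⁰⁰(x)` -/
def I00 : Set V := {i | M.H i x = 0 ∧ M.G i x = 0}

/-- The stationarity equation (first order condition on the Lagrangian). -/
def StatEq [Fintype E] [Fintype I] [Fintype V] (m : Mult E I V) : Prop :=
  fderiv ℝ M.f x + ∑ i, m.h i • fderiv ℝ (M.h i) x + ∑ i, m.g i • fderiv ℝ (M.g i) x
    + ∑ i, (-(m.H i • fderiv ℝ (M.H i) x) + m.G i • fderiv ℝ (M.G i) x) = 0

/-- The sign and complementarity conditions of weak stationarity. -/
def WeakCond (m : Mult E I V) : Prop :=
  (∀ i, m.g i * M.g i x = 0) ∧ (∀ i, m.H i * M.H i x = 0) ∧ (∀ i, m.G i * M.G i x = 0) ∧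
  (∀ i, 0 ≤ m.g i) ∧ (∀ i ∈ I0minus M x, 0 ≤ m.H i) ∧
  (∀ i ∈ I00 M x ∪ Iplus0 M x, 0 ≤ m.G i)

/-- The additional condition of M-stationarity. -/
def MCond (m : Mult E I V) : Prop := ∀ i ∈ I00 M x, m.H i * m.G i = 0

/-- `(β₁, β₂)` is a partition of `I⁰⁰(x)`. -/
def IsPartitionI00 (β₁ β₂ : Set V) : Prop := β₁ ∪ β₂ = I00 M x ∧ β₁ ∩ β₂ = ∅

/-- `up` and `lo` are the two multipliers `λ̅`, `λ̲` in the definition of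
Q-stationarity with respect to `(β₁, β₂)`. -/
def IsQPair [Fintype E] [Fintype I] [Fintype V] (β₁ β₂ : Set V) (up lo : Mult E I V) : Prop :=
  StatEq M x up ∧ WeakCond M x up ∧ StatEq M x lo ∧ WeakCond M x lo ∧
  (∀ i ∈ β₁, up.G i = 0 ∧ 0 ≤ lo.H i ∧ 0 ≤ lo.G i) ∧
  (∀ i ∈ β₂, 0 ≤ up.H i ∧ 0 ≤ up.G i ∧ lo.G i = 0)

/-- Q-stationarity with respect to the partition `(β₁, β₂)` of `I⁰⁰(x)`. -/
def QStationaryWrt [Fintype E] [Fintype I] [Fintype V] (β₁ β₂ : Set V) : Prop :=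
  Feasible M x ∧ IsPartitionI00 M x β₁ β₂ ∧ ∃ up lo, IsQPair M x β₁ β₂ up lo

/-- Q_M-stationarity. -/
def QMStationary [Fintype E] [Fintype I] [Fintype V] : Prop :=
  Feasible M x ∧ ∃ β₁ β₂, IsPartitionI00 M x β₁ β₂ ∧
    ∃ up lo, IsQPair M x β₁ β₂ up lo ∧ (MCond M x up ∨ MCond M x lo)

end Stationarity

/-! ### The sets `P`, `P¹`, `P²`, the `ℓ₁` distance and normal cones in the plane -/

def P : Set (ℝ × ℝ) := {u | u.1 ≤ 0 ∧ 0 ≤ u.1 * u.2}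

def P1 : Set (ℝ × ℝ) := {u | u.1 = 0}

def P2 : Set (ℝ × ℝ) := {u | u.1 ≤ 0 ∧ u.2 ≤ 0}

open Classical in
/-- For the partition `(W, V \ W)`: `P¹` for indices in `W`, `P²` for the other ones. -/
def PW {V : Type*} (W : Set V) (i : V) : Set (ℝ × ℝ) := if i ∈ W then P1 else P2

/-- `d(u, A) = inf_{y ∈ A} ‖u - y‖₁`. -/
def dist1 (u : ℝ × ℝ) (A : Set (ℝ × ℝ)) : ℝ :=
  sInf ((fun y : ℝ × ℝ => |u.1 - y.1| + |u.2 - y.2|) '' A)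

/-- The normal cone of convex analysis to `A` at `u`. -/
def normalCone (A : Set (ℝ × ℝ)) (u : ℝ × ℝ) : Set (ℝ × ℝ) :=
  {z | u ∈ A ∧ ∀ v ∈ A, z.1 * (v.1 - u.1) + z.2 * (v.2 - u.2) ≤ 0}

/-- `F i x = (-H i x, G i x)`. -/
def F {n : ℕ} {E I V : Type*} (M : Problem n E I V) (i : V) (x : Vec n) : ℝ × ℝ :=
  (-M.H i x, M.G i x)

/-- `∇(F i)(x) d = (-∇(H i)(x) d, ∇(G i)(x) d)`. -/
def dF {n : ℕ} {E I V : Type*} (M : Problem n E I V) (i : V) (x d : Vec n) : ℝ × ℝ :=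
  (-(fderiv ℝ (M.H i) x d), fderiv ℝ (M.G i) x d)

/-- The bilinear form `uᵀ B v`. -/
def bil {n : ℕ} (B : Matrix (Fin n) (Fin n) ℝ) (u v : Vec n) : ℝ :=
  dotProduct u.ofLp (B.mulVec v.ofLp)

/-! ### The auxiliary quadratic program and its solution procedure -/

/-- Data of the auxiliary problem: the matrix `B`, numbers `h i, g i, G i, H i` and row vectors
`∇f, ∇(h i), ∇(g i), ∇(G i), ∇(H i)`. -/
structure QPData (n : ℕ) (E I V : Type*) where
  B : Matrix (Fin n) (Fin n) ℝ
  df : Row n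
  h : E → ℝ
  dh : E → Row n
  g : I → ℝ
  dg : I → Row n
  G : V → ℝ
  dG : V → Row n
  H : V → ℝ
  dH : V → Row n

section Auxiliary

variable {n : ℕ} {E I V : Type*} (D : QPData n E I V)

def QPData.F (i : V) : ℝ × ℝ := (-D.H i, D.G i)

open Classical in
/-- `θᵍ` -/
def thetaG (i : I) : ℝ := if 0 < D.g i then 1 else 0

open Classical in
/-- `(θᴴ, θᴳ)` -/
def thetaF (i : V) : ℝ × ℝ :=
  if dist1 (D.F i) P = 0 then (0, 0)
  else if dist1 (D.F i) P1 ≤ dist1 (D.F i) P2 then (1, 0)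
  else (0, 1)

/-- The vector `(θᴴ H, -θᴳ G)`. -/
def shiftF (i : V) : ℝ × ℝ := ((thetaF D i).1 * D.H i, -((thetaF D i).2 * D.G i))

/-- `δ (θᴴ H, -θᴳ G) + F + ∇F s`. -/
def linF (s : Vec n) (δ : ℝ) (i : V) : ℝ × ℝ :=
  δ • shiftF D i + D.F i + (-(D.dH i s), D.dG i s)

/-- `I¹(s, δ)` -/
def auxI1 (s : Vec n) (δ : ℝ) : Set V := {i | linF D s δ i ∈ P1 \ P2}

/-- `I⁰⁰(s, δ)` -/
def auxI00 (s : Vec n) (δ : ℝ) : Set V := {i | linF D s δ i = (0, 0)}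

/-- Feasibility of `(s, δ)` for the convex piece `QP(ρ, W)`. -/
def QPFeasible (W : Set V) (s : Vec n) (δ : ℝ) : Prop :=
  (∀ i, (1 - δ) * D.h i + D.dh i s = 0) ∧
  (∀ i, (1 - thetaG D i * δ) * D.g i + D.dg i s ≤ 0) ∧
  (∀ i, linF D s δ i ∈ PW W i) ∧ 0 ≤ δ

def QPObj (ρ : ℝ) (s : Vec n) (δ : ℝ) : ℝ :=
  1 / 2 * bil D.B s s + D.df s + ρ * (1 / 2 * δ ^ 2 + δ)

/-- `(s, δ)` is a (global) solution of `QP(ρ, W)`. -/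
def QPSolution (ρ : ℝ) (W : Set V) (s : Vec n) (δ : ℝ) : Prop :=
  QPFeasible D W s δ ∧ ∀ s' δ', QPFeasible D W s' δ' → QPObj D ρ s δ ≤ QPObj D ρ s' δ'

/-- `m` is a multiplier corresponding to the point `(s, δ)` of `QP(ρ, W)`: the KKT conditions. -/
def QPMultiplier [Fintype E] [Fintype I] [Fintype V] (ρ : ℝ) (W : Set V) (s : Vec n) (δ : ℝ)
    (m : Mult E I V) : Prop :=
  (∀ v : Vec n, bil D.B v s + D.df v + ∑ i, m.h i * D.dh i v + ∑ i, m.g i * D.dg i v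
    + ∑ i, (-(m.H i * D.dH i v) + m.G i * D.dG i v) = 0) ∧
  (∃ mδ : ℝ, 0 ≤ mδ ∧ mδ * δ = 0 ∧
    ρ * (δ + 1) - mδ - ∑ i, m.h i * D.h i - ∑ i, m.g i * (thetaG D i * D.g i)
      + ∑ i, ((shiftF D i).1 * m.H i + (shiftF D i).2 * m.G i) = 0) ∧
  (∀ i, m.g i * ((1 - thetaG D i * δ) * D.g i + D.dg i s) = 0 ∧ 0 ≤ m.g i) ∧
  (∀ i, (m.H i, m.G i) ∈ normalCone (PW W i) (linF D s δ i))

/-- The optimal value of `min δ` over the feasible set of `QP(ρ, W)`. -/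
def deltaMin (W : Set V) : ℝ := sInf {δ | ∃ s, QPFeasible D W s δ}

/-- The index sets of the four convex problems of the improvement step, in this order, at the
point `(s, δ)` when the current piece is `W`. -/
def fourPieces (W : Set V) (s : Vec n) (δ : ℝ) : Fin 4 → Set V :=
  ![auxI1 D s δ ∪ (auxI00 D s δ ∩ W), auxI1 D s δ ∪ (auxI00 D s δ \ W),
    auxI1 D s δ, auxI1 D s δ ∪ auxI00 D s δ]

end Auxiliary

/-- A record `(sᵗ, δᵗ)`, `t = 0, …, N`, and `V₁ᵗ`, `λᵗ`, `t = 1, …, N` (entries beyond are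
irrelevant). -/
structure PassData (n : ℕ) (E I V : Type*) where
  N : ℕ
  s : ℕ → Vec n
  δ : ℕ → ℝ
  V₁ : ℕ → Set V
  lam : ℕ → Mult E I V

section AuxAlgorithm

variable {n : ℕ} {E I V : Type*} [Fintype E] [Fintype I] [Fintype V] (D : QPData n E I V)

/-- `p` records what the solution procedure computes with the fixed parameter `ρ`, from the last
time it entered the initialization until `(s^N, δ^N)` is available, no restart having been
triggered by `(sᵗ, δᵗ)` with `t < N`. -/
structure IsPass (ρ : ℝ) (p : PassData n E I V) : Prop where
  one_le : 1 ≤ p.N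
  s_zero : p.s 0 = 0
  δ_zero : p.δ 0 = 1
  V_one : p.V₁ 1 = auxI1 D 0 1
  sol : ∀ t, 1 ≤ t → t ≤ p.N → QPSolution D ρ (p.V₁ t) (p.s t) (p.δ t) ∧
    QPMultiplier D ρ (p.V₁ t) (p.s t) (p.δ t) (p.lam t)
  no_restart : ∀ t, 1 ≤ t → t < p.N → p.δ t ≤ p.δ (t - 1)
  improve : ∀ t, 1 ≤ t → t < p.N →
    (p.s (t + 1), p.δ (t + 1)) ≠ (p.s t, p.δ t) ∧
    ∃ j : Fin 4, p.V₁ (t + 1) = fourPieces D (p.V₁ t) (p.s t) (p.δ t) j ∧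
      ∀ i < j, QPSolution D ρ (fourPieces D (p.V₁ t) (p.s t) (p.δ t) i) (p.s t) (p.δ t)

/-- `(s^N, δ^N)` solves the four convex problems of the improvement step. -/
def ImprovementDone (ρ : ℝ) (p : PassData n E I V) : Prop :=
  ∀ j, QPSolution D ρ (fourPieces D (p.V₁ p.N) (p.s p.N) (p.δ p.N) j) (p.s p.N) (p.δ p.N)

/-- With the parameter `ρ` the procedure performs a restart, either because `δ` increased or
because the non-degeneracy condition holds although the improvement step ended with `δ ≥ ζ`. -/
def Restarts (ζ ρ : ℝ) : Prop :=
  ∃ p : PassData n E I V, IsPass D ρ p ∧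
    (p.δ (p.N - 1) < p.δ p.N ∨
      (p.δ p.N ≤ p.δ (p.N - 1) ∧ ImprovementDone D ρ p ∧ ζ ≤ p.δ p.N ∧
        min (deltaMin D (auxI1 D (p.s p.N) (p.δ p.N)))
          (deltaMin D (auxI1 D (p.s p.N) (p.δ p.N) ∪ auxI00 D (p.s p.N) (p.δ p.N))) < ζ))

/-- With the parameter `ρ` the procedure terminates successfully with the record `p`. -/
def Succeeds (ζ ρ : ℝ) (p : PassData n E I V) : Prop :=
  IsPass D ρ p ∧ p.δ p.N ≤ p.δ (p.N - 1) ∧ ImprovementDone D ρ p ∧ p.δ p.N < ζ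

/-- Started with `ρ`, and multiplying it by `ρbar` at each restart, the procedure terminates
successfully with the final parameter `ρ'` and the record `p`. -/
def AuxOutcome (ζ ρbar ρ ρ' : ℝ) (p : PassData n E I V) : Prop :=
  ∃ r : ℕ, ρ' = ρ * ρbar ^ r ∧ (∀ j < r, Restarts D ζ (ρ * ρbar ^ j)) ∧ Succeeds D ζ ρ' p

end AuxAlgorithm

/-- The auxiliary problem of the SQP method at the point `x` with the matrix `B`. -/
def auxData {n : ℕ} {E I V : Type*} (M : Problem n E I V) (B : Matrix (Fin n) (Fin n) ℝ)
    (x : Vec n) : QPData n E I V where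
  B := B
  df := fderiv ℝ M.f x
  h := fun i => M.h i x
  dh := fun i => fderiv ℝ (M.h i) x
  g := fun i => M.g i x
  dg := fun i => fderiv ℝ (M.g i) x
  G := fun i => M.G i x
  dG := fun i => fderiv ℝ (M.G i) x
  H := fun i => M.H i x
  dH := fun i => fderiv ℝ (M.H i) x

/-! ### Penalty parameters, merit functions and the line search -/

/-- Penalty parameters `(σʰ, σᵍ, σᶠ)`. -/
structure Pen (E I V : Type*) where
  h : E → ℝ
  g : I → ℝ
  F : V → ℝ

section Merit

variable {n : ℕ} {E I V : Type*}

/-- `λ̃ʰ_i = max_{1 ≤ t ≤ N} |λʰ_i|` -/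
def tildeH (p : PassData n E I V) (i : E) : ℝ :=
  sSup ((fun t => |(p.lam t).h i|) '' Set.Icc 1 p.N)

/-- `λ̃ᵍ_i = max_{1 ≤ t ≤ N} |λᵍ_i|` -/
def tildeG (p : PassData n E I V) (i : I) : ℝ :=
  sSup ((fun t => |(p.lam t).g i|) '' Set.Icc 1 p.N)

/-- `λ̃ᶠ_i = max_{1 ≤ t ≤ N} ‖(λᴴ_i, λᴳ_i)‖_∞` -/
def tildeF (p : PassData n E I V) (i : V) : ℝ :=
  sSup ((fun t => max |(p.lam t).H i| |(p.lam t).G i|) '' Set.Icc 1 p.N)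

open Classical in
/-- The update rule for one penalty parameter. -/
def updatePen (ξ₁ ξ₂ old lt : ℝ) : ℝ := if old < ξ₁ * lt then ξ₂ * lt else old

def newPen (ξ₁ ξ₂ : ℝ) (σ : Pen E I V) (p : PassData n E I V) : Pen E I V where
  h := fun i => updatePen ξ₁ ξ₂ (σ.h i) (tildeH p i)
  g := fun i => updatePen ξ₁ ξ₂ (σ.g i) (tildeG p i)
  F := fun i => updatePen ξ₁ ξ₂ (σ.F i) (tildeF p i)

variable [Fintype E] [Fintype I] [Fintype V] (M : Problem n E I V)

/-- The merit function `Φ`, with the distances to `P`. -/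
def Phi (σ : Pen E I V) (x : Vec n) : ℝ :=
  M.f x + ∑ i, σ.h i * |M.h i x| + ∑ i, σ.g i * max 0 (M.g i x)
    + ∑ i, σ.F i * dist1 (F M i x) P

/-- The merit function `φ` for the partition `(W, V \ W)`, with the distances to `P¹` for
`i ∈ W` and to `P²` otherwise. -/
def phiW (σ : Pen E I V) (W : Set V) (x : Vec n) : ℝ :=
  M.f x + ∑ i, σ.h i * |M.h i x| + ∑ i, σ.g i * max 0 (M.g i x)
    + ∑ i, σ.F i * dist1 (F M i x) (PW W i)

/-- The first order model of `s ↦ phiW σ W (x + s)` with the quadratic term `½ sᵀ B s`. -/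
def phiHatW (σ : Pen E I V) (B : Matrix (Fin n) (Fin n) ℝ) (W : Set V) (x s : Vec n) : ℝ :=
  M.f x + fderiv ℝ M.f x s + 1 / 2 * bil B s s
    + ∑ i, σ.h i * |M.h i x + fderiv ℝ (M.h i) x s|
    + ∑ i, σ.g i * max 0 (M.g i x + fderiv ℝ (M.g i) x s)
    + ∑ i, σ.F i * dist1 (F M i x + dF M i x s) (PW W i)

end Merit

section LineSearch

variable {n : ℕ} {E I V : Type*} (p : PassData n E I V)

/-- `(1 - α) s^{t-1} + α sᵗ` -/
def segPoint (t : ℕ) (α : ℝ) : Vec n := (1 - α) • p.s (t - 1) + α • p.s t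

/-- `Sᵗ = ∑_{τ=1}^t ‖s^τ - s^{τ-1}‖` -/
def lenS (t : ℕ) : ℝ := ∑ τ ∈ Finset.range t, ‖p.s (τ + 1) - p.s τ‖

open Classical in
/-- `t(γ)`: equal to `N` for `γ = 1`, otherwise the smallest `t` with `Sᵗ > γ S^N`. -/
def tIdx (γ : ℝ) : ℕ := if γ = 1 then p.N else sInf {t | γ * lenS p p.N < lenS p t}

open Classical in
/-- `α(γ)` -/
def alphaPar (γ : ℝ) : ℝ :=
  if γ = 1 then 1
  else (γ * lenS p p.N - lenS p (tIdx p γ - 1)) / (lenS p (tIdx p γ) - lenS p (tIdx p γ - 1))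

/-- The point `ŝ(γ)` of the polygonal line through `s⁰, …, s^N`. -/
def sHat (γ : ℝ) : Vec n :=
  p.s (tIdx p γ - 1) + alphaPar p γ • (p.s (tIdx p γ) - p.s (tIdx p γ - 1))

variable [Fintype E] [Fintype I] [Fintype V] (M : Problem n E I V)
  (σ : Pen E I V) (B : Matrix (Fin n) (Fin n) ℝ) (x : Vec n)

/-- `φᵗ(α)` -/
def phiT (t : ℕ) (α : ℝ) : ℝ := phiW M σ (p.V₁ t) (x + segPoint p t α)

/-- The model `φ̂ᵗ(α)` -/
def phiHatT (t : ℕ) (α : ℝ) : ℝ := phiHatW M σ B (p.V₁ t) x (segPoint p t α)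

/-- `Y(γ)` -/
def lsY (γ : ℝ) : ℝ := phiT p M σ x (tIdx p γ) (alphaPar p γ)

/-- `Z(γ)` -/
def lsZ (γ : ℝ) : ℝ :=
  (1 - alphaPar p γ) * phiHatT p M σ B x (tIdx p γ) 0
    + alphaPar p γ * phiHatT p M σ B x (tIdx p γ) 1

end LineSearch

/-! ### The linear program of the correction step -/

section LP

variable {n : ℕ} {E I V : Type*} (M : Problem n E I V)

def LPFeasible (x : Vec n) (W : Set V) (d : Vec n) : Prop :=
  (∀ i, fderiv ℝ (M.h i) x d = 0) ∧
  (∀ i, min 0 (M.g i x) + fderiv ℝ (M.g i) x d ≤ 0) ∧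
  (∀ i ∈ W, dF M i x d ∈ P1) ∧
  (∀ i ∉ W, (min 0 (F M i x).1, min 0 (F M i x).2) + dF M i x d ∈ P2) ∧
  (∀ j, -1 ≤ d j ∧ d j ≤ 1)

/-- `d` is a solution of `LP(x, W)`. -/
def LPSolution (x : Vec n) (W : Set V) (d : Vec n) : Prop :=
  LPFeasible M x W d ∧ ∀ d', LPFeasible M x W d' → fderiv ℝ M.f x d ≤ fderiv ℝ M.f x d'

end LP

/-! ### The extended SQP algorithm -/

/-- The constants of the algorithm. -/
structure Params where
  ζ : ℝ
  ρbar : ℝ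
  μ : ℝ
  ξ : ℝ
  ξ₁ : ℝ
  ξ₂ : ℝ
  γlo : ℝ
  γhi : ℝ
  αlo : ℝ
  αhi : ℝ
  hζ : 0 < ζ ∧ ζ < 1
  hρbar : 1 < ρbar
  hμ : 0 < μ ∧ μ < 1
  hξ : 0 < ξ ∧ ξ < 1
  hξ₁₂ : 1 < ξ₁ ∧ ξ₁ < ξ₂
  hγ : 0 < γlo ∧ γhi < 1
  hα : 0 < αlo ∧ αhi < 1

/-- The quantities generated by the algorithm, indexed by the iteration `k`. -/
structure Trace (n : ℕ) (E I V : Type*) where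
  /-- the iterates `x_k` -/
  x : ℕ → Vec n
  /-- the corrected iterates `x̃_k` -/
  xt : ℕ → Vec n
  B : ℕ → Matrix (Fin n) (Fin n) ℝ
  ρ : ℕ → ℝ
  /-- the initial penalty parameters `σ_{-1}` -/
  σinit : Pen E I V
  /-- the penalty parameters `σ_k` -/
  σ : ℕ → Pen E I V
  /-- the penalty parameters of the merit functions in the correction step of iteration `k` -/
  σcorr : ℕ → Pen E I V
  /-- the sets `W¹_{1,k}` and `W²_{1,k}` -/
  W1 : ℕ → Set V
  W2 : ℕ → Set V
  d1 : ℕ → Vec n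
  d2 : ℕ → Vec n
  /-- the chosen direction `d_k` and the set `W_{1,k}` belonging to it -/
  d : ℕ → Vec n
  W : ℕ → Set V
  /-- `α k j` is the `(j+1)`-st trial step size of the correction step -/
  α : ℕ → ℕ → ℝ
  /-- the outcome of the solution procedure for the auxiliary problem -/
  pass : ℕ → PassData n E I V
  /-- `γ k j` is the `(j+1)`-st trial parameter of the line search -/
  γ : ℕ → ℕ → ℝ

/-- `σ_{k-1}` -/
def Trace.σprev {n : ℕ} {E I V : Type*} (T : Trace n E I V) : ℕ → Pen E I V
  | 0 => T.σinit
  | k + 1 => T.σ k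

section Algorithm

variable {n : ℕ} {E I V : Type*} [Fintype E] [Fintype I] [Fintype V]
  (M : Problem n E I V) (A : Params) (T : Trace n E I V)

/-- The sufficient decrease condition for the trial step `α`. -/
def CorrDecrease (k : ℕ) (α : ℝ) : Prop :=
  Phi M (T.σcorr k) (T.x k + α • T.d k) - Phi M (T.σcorr k) (T.x k)
    ≤ A.μ * α * fderiv ℝ M.f (T.x k) (T.d k)

/-- The condition under which the correction step gives up. -/
def CorrGiveUp (k : ℕ) (α : ℝ) : Prop :=
  α ≤ (Phi M (T.σcorr k) (T.x k) - phiW M (T.σcorr k) (T.W k) (T.x k))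
    / (A.μ * fderiv ℝ M.f (T.x k) (T.d k))

/-- `T` is an infinite sequence of quantities generated by the extended algorithm (so that the
algorithm does not stop prematurely). -/
structure IsInfiniteRun : Prop where
  ρ_zero : 0 < T.ρ 0
  σinit_pos : (∀ i, 0 < T.σinit.h i) ∧ (∀ i, 0 < T.σinit.g i) ∧ (∀ i, 0 < T.σinit.F i)
  B_posDef : ∀ k, (T.B k).PosDef
  /- Correction of the iterate. The merit functions are formed with `σ_k`, or with the parameters
  `σ_{k-1}` that are already known at this stage. -/
  σcorr_eq : ∀ k, T.σcorr k = T.σ k ∨ T.σcorr k = T.σprev k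
  d1_sol : ∀ k, LPSolution M (T.x k) (T.W1 k) (T.d1 k)
  d2_sol : ∀ k, LPSolution M (T.x k) (T.W2 k) (T.d2 k)
  d_choice : ∀ k,
    (T.d k = T.d1 k ∧ T.W k = T.W1 k ∧
      fderiv ℝ M.f (T.x k) (T.d1 k) ≤ fderiv ℝ M.f (T.x k) (T.d2 k)) ∨
    (T.d k = T.d2 k ∧ T.W k = T.W2 k ∧
      fderiv ℝ M.f (T.x k) (T.d2 k) ≤ fderiv ℝ M.f (T.x k) (T.d1 k))
  α_zero : ∀ k, T.α k 0 = 1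
  α_ratio : ∀ k j, A.αlo ≤ T.α k (j + 1) / T.α k j ∧ T.α k (j + 1) / T.α k j ≤ A.αhi
  correct : ∀ k, fderiv ℝ M.f (T.x k) (T.d k) < 0 →
    ∃ j, IsLeast {j | CorrDecrease M A T k (T.α k j) ∨ CorrGiveUp M A T k (T.α k j)} j ∧
      (CorrDecrease M A T k (T.α k j) → T.xt k = T.x k + T.α k j • T.d k) ∧
      (¬ CorrDecrease M A T k (T.α k j) → T.xt k = T.x k)
  no_correct : ∀ k, ¬ fderiv ℝ M.f (T.x k) (T.d k) < 0 → T.xt k = T.x k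
  /- Solution of the auxiliary problem at the corrected iterate. -/
  aux : ∀ k, AuxOutcome (auxData M (T.B k) (T.xt k)) A.ζ A.ρbar (T.ρ k) (T.ρ (k + 1)) (T.pass k)
  s_ne_zero : ∀ k, (T.pass k).s (T.pass k).N ≠ 0
  /- Next iterate. -/
  σ_update : ∀ k, T.σ k = newPen A.ξ₁ A.ξ₂ (T.σprev k) (T.pass k)
  γ_zero : ∀ k, T.γ k 0 = 1
  γ_ratio : ∀ k j, A.γlo ≤ T.γ k (j + 1) / T.γ k j ∧ T.γ k (j + 1) / T.γ k j ≤ A.γhi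
  next : ∀ k, ∃ j, IsLeast
      {j | lsY (T.pass k) M (T.σ k) (T.xt k) (T.γ k j) - lsY (T.pass k) M (T.σ k) (T.xt k) 0
        ≤ A.ξ * (lsZ (T.pass k) M (T.σ k) (T.B k) (T.xt k) (T.γ k j)
            - lsZ (T.pass k) M (T.σ k) (T.B k) (T.xt k) 0)} j ∧
      T.x (k + 1) = T.xt k + sHat (T.pass k) (T.γ k j)

end Algorithm

/-! ### The assumptions of the convergence theorem -/

section Assumptions

variable {n : ℕ} {E I V : Type*}

/-- Boundedness of the iterates, of the lengths of the polygonal lines and of the multipliers;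
the matrices `B_k` are bounded and their smallest eigenvalues are bounded away from zero. -/
def BoundednessAssumption (T : Trace n E I V) : Prop :=
  (∃ Cx Cs Cl : ℝ, ∀ k, ‖T.x k‖ ≤ Cx ∧ lenS (T.pass k) (T.pass k).N ≤ Cs ∧
    (∀ i, tildeH (T.pass k) i ≤ Cl) ∧ (∀ i, tildeG (T.pass k) i ≤ Cl) ∧
    (∀ i, tildeF (T.pass k) i ≤ Cl)) ∧
  (∃ cB CB : ℝ, 0 < cB ∧ ∀ k,
    (∃ hB : (T.B k).IsHermitian, ∀ j, cB ≤ hB.eigenvalues j) ∧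
    (∀ u : Vec n, (∀ j, |u j| ≤ 1) → ‖WithLp.toLp 2 ((T.B k).mulVec u.ofLp)‖ ≤ CB))

/-- The Mangasarian–Fromovitz constraint qualification at `x` for `a = 0`, `b ≤ 0`. -/
def MFCQ {ι κ : Type*} (a : ι → Vec n → ℝ) (b : κ → Vec n → ℝ) (x : Vec n) : Prop :=
  LinearIndependent ℝ (fun i => fderiv ℝ (a i) x) ∧
  ∃ d : Vec n, (∀ i, fderiv ℝ (a i) x d = 0) ∧ ∀ i, b i x = 0 → fderiv ℝ (b i) x d < 0

variable (M : Problem n E I V)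

/-- The equality constraints `h i` (`i ∈ E`), `-H i` (`i ∈ W`). -/
def aW (W : Set V) : E ⊕ W → Vec n → ℝ :=
  Sum.elim M.h (fun i x => -M.H i.1 x)

/-- The inequality constraints `g i` (`i ∈ I`), `-H i` (`i ∉ W`), `G i` (`i ∉ W`). -/
def bW (W : Set V) : I ⊕ (↥Wᶜ ⊕ ↥Wᶜ) → Vec n → ℝ :=
  Sum.elim M.g (Sum.elim (fun i x => -M.H i.1 x) (fun i => M.G i.1))

/-- The assumption on a limit point `x`: MFCQ for both partitions, and correct identification
of `I⁰⁺(x)` and `I⁰⁺(x) ∪ I⁰⁰(x)` along a subsequence converging to `x`. -/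
def LimitPointAssumption (T : Trace n E I V) (x : Vec n) : Prop :=
  MFCQ (aW M (I0plus M x)) (bW M (I0plus M x)) x ∧
  MFCQ (aW M (I0plus M x ∪ I00 M x)) (bW M (I0plus M x ∪ I00 M x)) x ∧
  ∃ K : Set ℕ, K.Infinite ∧ Tendsto T.x (atTop ⊓ 𝓟 K) (𝓝 x) ∧
    ∀ k ∈ K, T.W1 k = I0plus M x ∧ T.W2 k = I0plus M x ∪ I00 M x

end Assumptions

end MPVC

end

/-!
The proof has two halves: the limit point is feasible and the correction steps cannot make progress
there, and the latter, by duality, provides the two multipliers.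

*Descent.* Since the multipliers are bounded, the penalty parameters become constant
(`exists_eventually_eq_of_updatePen`), and from then on a single merit function `Phi` decreases
(`IsInfiniteRun.exists_limit_penalty`). For the line search, the models of the different pieces are
all majorized by one function of `(s, δ)`, the `elasticModel`, which equals `Phi` at `(0, 1)`. The
KKT conditions of the piece solved in step `t` show that it drops by at least half the squared
`B`-norm of the step (`elasticModel_descent`). A strict decrease of the objective from piece to
piece bounds the number of steps by the number of subsets of `V` (`IsPass.N_le`). The squared step
lengths alone do not bound the line search parameter from below, because the Taylor remainder of a
`C¹` function is only `o(‖s‖)`; the remedy is an induction over the auxiliary steps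
(`exists_decrease_of_step`): at the first step that is not small, the model decreases linearly in
the arc length. Hence the polygonal lines become arbitrarily short.

*Feasibility.* The limit point is also the limit of the preceding corrected iterates, whose
auxiliary problems have short final steps and `δ < ζ < 1`. The feasibility conditions of the pieces
bound the constraint violation by the step length (`QPFeasible.dist1_le`,
`feasible_of_tendsto_of_qpFeasible`).

*Correction.* Suppose that one of the two systems has a strict linearized descent direction at the
limit. Linear independence of the equality gradients lets it persist as a feasible direction of the
linear programs nearby (`exists_lpFeasible_of_strict`), with values bounded away from zero. On a
fixed window of step sizes the sufficient decrease condition then holds, while the bound that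
triggers giving up tends to zero, so `Phi` would decrease by a fixed amount infinitely often
(`IsInfiniteRun.not_exists_strict`).

*Multipliers.* Without strict descent directions, Gordan's theorem on the kernel of the equality
gradients, together with the constraint qualification, gives multipliers for both systems
(`exists_multipliers_of_no_strict`). With `W = I⁰⁺` the indices in `I⁰⁰` carry two inequality
constraints, so both their multipliers are nonnegative; with `W = I⁰⁺ ∪ I⁰⁰` the function `G i` does
not occur for them, so `λᴳ = 0`. The latter is also the additional condition of M-stationarity.
-/

namespace MPVC

/-! ### Distances in the plane -/

lemma dist1_P1 (u : ℝ × ℝ) : dist1 u P1 = |u.1| := by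
  refine IsLeast.csInf_eq ⟨⟨(0, u.2), rfl, by simp⟩, ?_⟩
  rintro _ ⟨y, hy, rfl⟩
  have hy : y.1 = 0 := hy
  simp [hy]

lemma dist1_P2 (u : ℝ × ℝ) : dist1 u P2 = max 0 u.1 + max 0 u.2 := by
  have key : ∀ a : ℝ, |a - min 0 a| = max 0 a := fun a => by
    rcases le_total 0 a with h | h <;> simp [h]
  have low : ∀ a b : ℝ, b ≤ 0 → max 0 a ≤ |a - b| := fun a b hb =>
    max_le (abs_nonneg _) (by linarith [le_abs_self (a - b)])
  refine IsLeast.csInf_eq ⟨⟨(min 0 u.1, min 0 u.2), ⟨by simp, by simp⟩, by simp [key]⟩, ?_⟩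
  rintro _ ⟨y, hy, rfl⟩
  exact add_le_add (low _ _ hy.1) (low _ _ hy.2)

lemma P_eq_union : P = P1 ∪ P2 := by
  ext u
  simp only [P, P1, P2, Set.mem_ofPred_eq, Set.mem_union]
  constructor
  · rintro ⟨h1, h2⟩
    rcases h1.lt_or_eq with h | h
    · exact Or.inr ⟨h1, by by_contra! h3; nlinarith⟩
    · exact Or.inl h
  · rintro (h | ⟨h1, h2⟩)
    · simp [h]
    · exact ⟨h1, mul_nonneg_of_nonpos_of_nonpos h1 h2⟩

lemma dist1_P (u : ℝ × ℝ) : dist1 u P = min |u.1| (max 0 u.1 + max 0 u.2) := by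
  rw [P_eq_union, dist1, Set.image_union, csInf_union]
  · exact congrArg₂ min (dist1_P1 u) (dist1_P2 u)
  · exact ⟨0, by rintro _ ⟨y, -, rfl⟩; positivity⟩
  · exact ⟨_, (0, 0), rfl, rfl⟩
  · exact ⟨0, by rintro _ ⟨y, -, rfl⟩; positivity⟩
  · exact ⟨_, (0, 0), ⟨le_rfl, le_rfl⟩, rfl⟩

variable {V : Type*}

lemma dist1_PW_of_mem {W : Set V} {i : V} (hi : i ∈ W) (u : ℝ × ℝ) :
    dist1 u (PW W i) = |u.1| := by
  rw [PW, if_pos hi, dist1_P1]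

lemma dist1_PW_of_notMem {W : Set V} {i : V} (hi : i ∉ W) (u : ℝ × ℝ) :
    dist1 u (PW W i) = max 0 u.1 + max 0 u.2 := by
  rw [PW, if_neg hi, dist1_P2]

lemma mem_PW_of_mem {W : Set V} {i : V} (hi : i ∈ W) {u : ℝ × ℝ} :
    u ∈ PW W i ↔ u.1 = 0 := by
  rw [PW, if_pos hi]; rfl

lemma mem_PW_of_notMem {W : Set V} {i : V} (hi : i ∉ W) {u : ℝ × ℝ} :
    u ∈ PW W i ↔ u.1 ≤ 0 ∧ u.2 ≤ 0 := by
  rw [PW, if_neg hi]; rfl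

lemma dist1_P_nonneg (u : ℝ × ℝ) : 0 ≤ dist1 u P := by
  rw [dist1_P]; positivity

lemma dist1_P_le_PW (W : Set V) (i : V) (u : ℝ × ℝ) : dist1 u P ≤ dist1 u (PW W i) := by
  rw [dist1_P]
  by_cases hi : i ∈ W
  · rw [dist1_PW_of_mem hi]; exact min_le_left _ _
  · rw [dist1_PW_of_notMem hi]; exact min_le_right _ _

lemma dist1_P_eq_zero {u : ℝ × ℝ} : dist1 u P = 0 ↔ u ∈ P := by
  rw [dist1_P, P_eq_union]
  simp only [P1, P2, Set.mem_union, Set.mem_ofPred_eq]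
  constructor
  · intro h
    rcases min_choice |u.1| (max 0 u.1 + max 0 u.2) with h' | h'
    · left; rw [h'] at h; simpa using h
    · right
      rw [h'] at h
      constructor <;> linarith [le_max_left 0 u.1, le_max_right 0 u.1, le_max_left 0 u.2,
        le_max_right 0 u.2]
  · rintro (h | ⟨h1, h2⟩)
    · rw [h]; simp
    · rw [max_eq_left h1, max_eq_left h2]; simp

lemma dist1_PW_eq_zero {W : Set V} {i : V} {u : ℝ × ℝ} (hu : u ∈ PW W i) :
    dist1 u (PW W i) = 0 := by
  by_cases hi : i ∈ W
  · rw [dist1_PW_of_mem hi, (mem_PW_of_mem hi).1 hu, abs_zero]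
  · obtain ⟨h1, h2⟩ := (mem_PW_of_notMem hi).1 hu
    rw [dist1_PW_of_notMem hi, max_eq_left h1, max_eq_left h2, add_zero]

lemma dist1_PW_le_add (W : Set V) (i : V) (u v : ℝ × ℝ) :
    dist1 u (PW W i) ≤ dist1 v (PW W i) + (|u.1 - v.1| + |u.2 - v.2|) := by
  by_cases hi : i ∈ W
  · rw [dist1_PW_of_mem hi, dist1_PW_of_mem hi]
    linarith [abs_sub_abs_le_abs_sub u.1 v.1, abs_nonneg (u.2 - v.2)]
  · rw [dist1_PW_of_notMem hi, dist1_PW_of_notMem hi]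
    have key : ∀ a b : ℝ, max 0 a ≤ max 0 b + |a - b| := fun a b =>
      max_le (by positivity) (by linarith [le_abs_self (a - b), le_max_right 0 b])
    linarith [key u.1 v.1, key u.2 v.2]

lemma max_zero_combo_le {α : ℝ} (h0 : 0 ≤ α) (h1 : α ≤ 1) (a b : ℝ) :
    max 0 ((1 - α) * a + α * b) ≤ (1 - α) * max 0 a + α * max 0 b := by
  have h1' : 0 ≤ 1 - α := by linarith
  exact max_le (by positivity) (add_le_add (mul_le_mul_of_nonneg_left (le_max_right _ _) h1')
    (mul_le_mul_of_nonneg_left (le_max_right _ _) h0))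

lemma abs_combo_le {α : ℝ} (h0 : 0 ≤ α) (h1 : α ≤ 1) (a b : ℝ) :
    |(1 - α) * a + α * b| ≤ (1 - α) * |a| + α * |b| := by
  have h1' : 0 ≤ 1 - α := by linarith
  calc _ ≤ |(1 - α) * a| + |α * b| := abs_add_le _ _
    _ = _ := by rw [abs_mul, abs_mul, abs_of_nonneg h0, abs_of_nonneg h1']

lemma dist1_PW_combo_le (W : Set V) (i : V) {α : ℝ} (h0 : 0 ≤ α) (h1 : α ≤ 1) (u v : ℝ × ℝ) :
    dist1 ((1 - α) • u + α • v) (PW W i)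
      ≤ (1 - α) * dist1 u (PW W i) + α * dist1 v (PW W i) := by
  by_cases hi : i ∈ W
  · simp only [dist1_PW_of_mem hi]
    exact abs_combo_le h0 h1 _ _
  · simp only [dist1_PW_of_notMem hi]
    have e1 := max_zero_combo_le h0 h1 u.1 v.1
    have e2 := max_zero_combo_le h0 h1 u.2 v.2
    simp only [Prod.fst_add, Prod.snd_add, Prod.smul_fst, Prod.smul_snd, smul_eq_mul]
    linarith

/-! ### The bilinear form -/

section Bil

variable {n : ℕ} (B : Matrix (Fin n) (Fin n) ℝ)

lemma bil_add_left (u v w : Vec n) : bil B (u + v) w = bil B u w + bil B v w := by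
  simp [bil, add_dotProduct]

lemma bil_add_right (u v w : Vec n) : bil B u (v + w) = bil B u v + bil B u w := by
  simp [bil, Matrix.mulVec_add, dotProduct_add]

lemma bil_smul_left (a : ℝ) (u v : Vec n) : bil B (a • u) v = a * bil B u v := by
  simp [bil, smul_dotProduct]

lemma bil_smul_right (a : ℝ) (u v : Vec n) : bil B u (a • v) = a * bil B u v := by
  simp [bil, Matrix.mulVec_smul, dotProduct_smul]

variable {B}

lemma bil_comm (hB : B.IsHermitian) (u v : Vec n) : bil B u v = bil B v u := by
  have hT : B.transpose = B := by
    rw [← Matrix.conjTranspose_eq_transpose_of_trivial]; exact hB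
  rw [bil, bil, Matrix.dotProduct_mulVec, ← Matrix.mulVec_transpose, hT, dotProduct_comm]

lemma bil_combo (hB : B.IsHermitian) (α : ℝ) (u v : Vec n) :
    bil B ((1 - α) • u + α • v) ((1 - α) • u + α • v)
      = (1 - α) * bil B u u + α * bil B v v - α * (1 - α) * bil B (v - u) (v - u) := by
  simp only [sub_eq_add_neg v u, ← neg_one_smul ℝ u, bil_add_left, bil_add_right, bil_smul_left,
    bil_smul_right, bil_comm hB v u]
  ring

lemma bil_self_nonneg (hB : B.PosDef) (u : Vec n) : 0 ≤ bil B u u := by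
  simpa [bil] using hB.posSemidef.dotProduct_mulVec_nonneg u.ofLp

lemma bil_self_pos (hB : B.PosDef) {u : Vec n} (hu : u ≠ 0) : 0 < bil B u u := by
  have : u.ofLp ≠ 0 := fun h => hu (by ext i; simp [h])
  simpa [bil] using hB.dotProduct_mulVec_pos this

lemma bil_self_ge_of_eigenvalues (hB : B.IsHermitian) {c : ℝ} (hc : ∀ j, c ≤ hB.eigenvalues j)
    (u : Vec n) : c * ‖u‖ ^ 2 ≤ bil B u u := by
  set v := hB.eigenvectorBasis
  have hbil : ∀ a b : Vec n,
      bil B a b = inner ℝ (WithLp.toLp 2 (B.mulVec b.ofLp)) a := fun a b => by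
    simp [bil, PiLp.inner_apply, dotProduct, mul_comm]
  have hv : ∀ j a, bil B (v j) a = hB.eigenvalues j * inner ℝ (v j) a := fun j a => by
    rw [bil_comm hB, hbil, hB.mulVec_eigenvectorBasis]
    exact real_inner_smul_left (v j) a _
  have hu : bil B u u = ∑ j, hB.eigenvalues j * (inner ℝ (v j) u * inner ℝ (v j) u) := by
    rw [hbil, ← v.sum_inner_mul_inner]
    refine Finset.sum_congr rfl fun j _ => ?_
    rw [← hbil, hv, mul_assoc]
  have hn : ‖u‖ ^ 2 = ∑ j, inner ℝ (v j) u * inner ℝ (v j) u := by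
    rw [← real_inner_self_eq_norm_sq, ← v.sum_inner_mul_inner]
    exact Finset.sum_congr rfl fun j _ => by rw [real_inner_comm u]
  rw [hu, hn, Finset.mul_sum]
  exact Finset.sum_le_sum fun j _ => mul_le_mul_of_nonneg_right (hc j) (mul_self_nonneg _)

end Bil

/-! ### The convex pieces of the auxiliary problem -/

section QP

variable {n : ℕ} {E I V : Type*} {D : QPData n E I V}

/-- The three cases in the definition of `θ` in terms of the values of `H` and `G`. -/
lemma shiftF_cases (D : QPData n E I V) (i : V) :
    (shiftF D i = (0, 0) ∧ dist1 (D.F i) P = 0 ∧ 0 ≤ D.H i ∧ (D.H i = 0 ∨ D.G i ≤ 0)) ∨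
    (shiftF D i = (D.H i, 0) ∧ dist1 (D.F i) P = |D.H i| ∧
      (D.H i < 0 ∨ 0 < D.H i ∧ D.H i ≤ D.G i)) ∨
    (shiftF D i = (0, -D.G i) ∧ dist1 (D.F i) P = D.G i ∧ 0 < D.G i ∧ D.G i < D.H i) := by
  have hP := dist1_P (D.F i)
  unfold shiftF thetaF
  split_ifs with h0 h1
  · refine Or.inl ⟨by simp, h0, ?_⟩
    rw [dist1_P_eq_zero, P_eq_union] at h0
    rcases h0 with h0 | ⟨h0, h0'⟩
    · have : -D.H i = 0 := h0
      constructor <;> [linarith; (left; linarith)]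
    · have : -D.H i ≤ 0 := h0
      exact ⟨by linarith, Or.inr h0'⟩
  · refine Or.inr (Or.inl ⟨by simp, ?_⟩)
    rw [dist1_P1, dist1_P2] at h1
    rw [min_eq_left h1] at hP
    have hH : D.H i ≠ 0 := fun h => h0 (by rw [hP]; simp [QPData.F, h])
    refine ⟨by rw [hP]; simp [QPData.F], ?_⟩
    rcases hH.lt_or_gt with h | h
    · exact Or.inl h
    · refine Or.inr ⟨h, ?_⟩
      have h1 : |-D.H i| ≤ max 0 (-D.H i) + max 0 (D.G i) := h1
      rw [abs_neg, abs_of_pos h, max_eq_left (by linarith : -D.H i ≤ 0), zero_add] at h1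
      exact (le_max_iff.1 h1).resolve_left (by linarith)
  · refine Or.inr (Or.inr ⟨by simp, ?_⟩)
    rw [dist1_P1, dist1_P2, not_le] at h1
    rw [min_eq_right h1.le] at hP
    have h1 : max 0 (-D.H i) + max 0 (D.G i) < |-D.H i| := h1
    have hP : dist1 (D.F i) P = max 0 (-D.H i) + max 0 (D.G i) := hP
    rw [hP] at h0
    rw [abs_neg] at h1
    have hH : 0 < D.H i := by
      by_contra! h
      rw [abs_of_nonpos h] at h1
      linarith [le_max_right 0 (-D.H i), le_max_left 0 (D.G i)]
    rw [abs_of_pos hH, max_eq_left (by linarith : -D.H i ≤ 0), zero_add] at h1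
    rw [max_eq_left (by linarith : -D.H i ≤ 0), zero_add] at h0 hP
    have hG : 0 < D.G i := by
      by_contra! h
      exact h0 (max_eq_left h)
    rw [max_eq_right hG.le] at h1 hP
    exact ⟨hP, hG, h1⟩

lemma abs_shiftF (D : QPData n E I V) (i : V) :
    |(shiftF D i).1| + |(shiftF D i).2| = dist1 (D.F i) P := by
  rcases shiftF_cases D i with ⟨h, h', -⟩ | ⟨h, h', -⟩ | ⟨h, h', h'', -⟩ <;> rw [h, h'] <;> simp
  exact h''.le

lemma linF_fst (D : QPData n E I V) (s : Vec n) (δ : ℝ) (i : V) :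
    (linF D s δ i).1 = δ * (shiftF D i).1 - D.H i - D.dH i s := by
  simp [linF, QPData.F]; ring

lemma linF_snd (D : QPData n E I V) (s : Vec n) (δ : ℝ) (i : V) :
    (linF D s δ i).2 = δ * (shiftF D i).2 + D.G i + D.dG i s := by
  simp [linF, QPData.F]

lemma qpFeasible_zero_one (D : QPData n E I V) : QPFeasible D (auxI1 D 0 1) 0 1 := by
  refine ⟨by simp, fun i => ?_, fun i => ?_, zero_le_one⟩
  · by_cases h : 0 < D.g i
    · simp [thetaG, h]
    · simpa [thetaG, h] using not_lt.1 h
  · have hu : linF D 0 1 i ∈ P1 ∪ P2 := by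
      change (linF D 0 1 i).1 = 0 ∨ ((linF D 0 1 i).1 ≤ 0 ∧ (linF D 0 1 i).2 ≤ 0)
      rw [linF_fst, linF_snd]
      rcases shiftF_cases D i with ⟨h, -, h1, h2⟩ | ⟨h, -, -⟩ | ⟨h, -, h1, h2⟩ <;> rw [h] <;> simp
      · rcases h2 with h2 | h2
        · exact Or.inl h2
        · exact Or.inr ⟨h1, h2⟩
      · right; linarith
    by_cases hi : i ∈ auxI1 D 0 1
    · rw [PW, if_pos hi]; exact hi.1
    · rw [PW, if_neg hi]
      by_contra h
      exact hi ⟨hu.resolve_right h, h⟩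

/-- A feasible point stays feasible on the four pieces of the improvement step, since these only
redistribute the indices where both branches of the constraint are satisfied. -/
lemma QPFeasible.on_fourPieces {W : Set V} {s : Vec n} {δ : ℝ} (h : QPFeasible D W s δ)
    (j : Fin 4) : QPFeasible D (fourPieces D W s δ j) s δ := by
  refine ⟨h.1, h.2.1, fun i => ?_, h.2.2.2⟩
  have hsub : auxI1 D s δ ⊆ fourPieces D W s δ j ∧
      fourPieces D W s δ j ⊆ auxI1 D s δ ∪ auxI00 D s δ := by
    fin_cases j
    · exact ⟨Set.subset_union_left, Set.union_subset_union_right _ Set.inter_subset_left⟩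
    · exact ⟨Set.subset_union_left, Set.union_subset_union_right _ Set.sdiff_subset⟩
    · exact ⟨subset_rfl, Set.subset_union_left⟩
    · exact ⟨Set.subset_union_left, subset_rfl⟩
  have hu : linF D s δ i ∈ P1 ∪ P2 := by
    have := h.2.2.1 i
    unfold PW at this
    split_ifs at this
    · exact Or.inl this
    · exact Or.inr this
  by_cases hi : i ∈ fourPieces D W s δ j
  · rw [PW, if_pos hi]
    rcases hsub.2 hi with h' | h'
    · exact h'.1
    · change (linF D s δ i).1 = 0
      rw [show linF D s δ i = (0, 0) from h']
  · rw [PW, if_neg hi]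
    by_contra h'
    exact hi (hsub.1 ⟨hu.resolve_right h', h'⟩)

lemma QPFeasible.abs_lin_h {W : Set V} {s : Vec n} {δ : ℝ} (h : QPFeasible D W s δ) (i : E) :
    |D.h i + D.dh i s| = δ * |D.h i| := by
  rw [show D.h i + D.dh i s = δ * D.h i by linarith [h.1 i], abs_mul, abs_of_nonneg h.2.2.2]

lemma thetaG_mul (D : QPData n E I V) (i : I) : thetaG D i * D.g i = max 0 (D.g i) := by
  unfold thetaG
  split_ifs with h
  · rw [max_eq_right h.le, one_mul]
  · rw [max_eq_left (not_lt.1 h), zero_mul]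

lemma QPFeasible.max_lin_g {W : Set V} {s : Vec n} {δ : ℝ} (h : QPFeasible D W s δ) (i : I) :
    max 0 (D.g i + D.dg i s) ≤ δ * max 0 (D.g i) := by
  refine max_le (mul_nonneg h.2.2.2 (le_max_left _ _)) ?_
  have := h.2.1 i
  rw [← thetaG_mul]
  linarith

/-- The linearized vanishing constraint is violated by at most `δ` times the violation at the
base point, also after the elastic shift has been dropped. -/
lemma QPFeasible.dist1_lin {W : Set V} {s : Vec n} {δ : ℝ} (h : QPFeasible D W s δ) (i : V) :
    dist1 (D.F i + (-(D.dH i s), D.dG i s)) (PW W i) ≤ δ * dist1 (D.F i) P := by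
  have h0 : linF D s δ i ∈ PW W i := h.2.2.1 i
  have h1 : linF D s δ i = δ • shiftF D i + (D.F i + (-(D.dH i s), D.dG i s)) := by
    rw [linF, add_assoc]
  have := dist1_PW_le_add W i (D.F i + (-(D.dH i s), D.dG i s)) (linF D s δ i)
  rw [dist1_PW_eq_zero h0, zero_add] at this
  refine this.trans_eq ?_
  rw [h1, ← abs_shiftF, ← Prod.fst_sub, ← Prod.snd_sub, sub_add_cancel_right]
  simp [abs_mul, abs_of_nonneg h.2.2.2]
  ring

/-- The violation of the vanishing constraint at the base point is controlled by the change of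
the linearization along a feasible step with `δ < 1`. -/
lemma QPFeasible.dist1_le {W : Set V} {s : Vec n} {δ : ℝ} (h : QPFeasible D W s δ) (hδ : δ < 1)
    (i : V) : (1 - δ) * dist1 (D.F i) P ≤ |D.dH i s| + |D.dG i s| := by
  have h0 := h.2.2.1 i
  have hδ0 := h.2.2.2
  have a1 := neg_abs_le (D.dH i s)
  have a2 := le_abs_self (D.dH i s)
  have a3 := neg_abs_le (D.dG i s)
  have a4 := le_abs_self (D.dG i s)
  have a5 := abs_nonneg (D.dH i s)
  have a6 := abs_nonneg (D.dG i s)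
  by_cases hi : i ∈ W
  · have h0 := (mem_PW_of_mem hi).1 h0
    rw [linF_fst] at h0
    rcases shiftF_cases D i with ⟨hs, hd, -⟩ | ⟨hs, hd, -⟩ | ⟨hs, hd, h1, h2⟩ <;>
      rw [hs] at h0 <;> rw [hd] <;> simp only at h0
    · linarith
    · rw [← abs_of_pos (sub_pos.2 hδ), ← abs_mul,
        show (1 - δ) * D.H i = -(D.dH i s) by linarith, abs_neg]
      linarith
    · nlinarith
  · obtain ⟨h0, h0'⟩ := (mem_PW_of_notMem hi).1 h0
    rw [linF_fst] at h0
    rw [linF_snd] at h0'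
    rcases shiftF_cases D i with ⟨hs, hd, -⟩ | ⟨hs, hd, h1 | ⟨h1, h2⟩⟩ | ⟨hs, hd, h1, h2⟩ <;>
      rw [hs] at h0 h0' <;> rw [hd] <;> simp only at h0 h0'
    · linarith
    · rw [abs_of_neg h1]; linarith
    · rw [abs_of_pos h1]; nlinarith
    · linarith

lemma QPFeasible.midpoint {W : Set V} {s s' : Vec n} {δ δ' : ℝ} (h : QPFeasible D W s δ)
    (h' : QPFeasible D W s' δ') :
    QPFeasible D W ((1 / 2 : ℝ) • s + (1 / 2 : ℝ) • s') (1 / 2 * δ + 1 / 2 * δ') := by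
  refine ⟨fun i => ?_, fun i => ?_, fun i => ?_, ?_⟩
  · have e1 := h.1 i
    have e2 := h'.1 i
    simp only [map_add, map_smul, smul_eq_mul]
    linarith
  · have e1 := h.2.1 i
    have e2 := h'.2.1 i
    simp only [map_add, map_smul, smul_eq_mul]
    linarith
  · have e1 := h.2.2.1 i
    have e2 := h'.2.2.1 i
    by_cases hi : i ∈ W
    · rw [mem_PW_of_mem hi, linF_fst] at *
      simp only [map_add, map_smul, smul_eq_mul]
      linarith
    · rw [mem_PW_of_notMem hi, linF_fst, linF_snd] at *
      simp only [map_add, map_smul, smul_eq_mul]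
      constructor <;> linarith
  · linarith [h.2.2.2, h'.2.2.2]

/-- Solutions of the strictly convex pieces are unique. -/
lemma QPSolution.unique (hB : D.B.PosDef) {ρ : ℝ} (hρ : 0 < ρ) {W : Set V} {s s' : Vec n}
    {δ δ' : ℝ} (h : QPSolution D ρ W s δ) (h' : QPFeasible D W s' δ')
    (hle : QPObj D ρ s' δ' ≤ QPObj D ρ s δ) : (s', δ') = (s, δ) := by
  have hm := h.2 _ _ (h.1.midpoint h')
  have hc := bil_combo hB.isHermitian (1 / 2) s s'
  rw [show (1 - 1 / 2 : ℝ) = 1 / 2 by norm_num] at hc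
  unfold QPObj at hm hle
  rw [hc] at hm
  simp only [map_add, map_smul, smul_eq_mul] at hm
  have hb := bil_self_nonneg hB (s' - s)
  have hkey : 1 / 8 * bil D.B (s' - s) (s' - s) + ρ * (1 / 8 * (δ' - δ) ^ 2) ≤ 0 := by
    linarith
  have hδ2 : 0 ≤ ρ * (1 / 8 * (δ' - δ) ^ 2) := by positivity
  have hδ : δ' - δ = 0 := by
    by_contra hne
    have : 0 < ρ * (1 / 8 * (δ' - δ) ^ 2) := by positivity
    linarith
  have hs : s' - s = 0 := by
    by_contra hne
    linarith [bil_self_pos hB hne]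
  rw [sub_eq_zero.1 hδ, sub_eq_zero.1 hs]

end QP

/-! ### The iterates of the auxiliary procedure -/

section Pass

variable {n : ℕ} {E I V : Type*} [Fintype E] [Fintype I] [Fintype V] {D : QPData n E I V}
  {ζ ρ : ℝ} {p : PassData n E I V}

/-- The previous point `(s^{t-1}, δ^{t-1})` is feasible for the piece solved in step `t`. -/
lemma IsPass.feasible_prev (h : IsPass D ρ p) {t : ℕ} (h1 : 1 ≤ t) (hN : t ≤ p.N) :
    QPFeasible D (p.V₁ t) (p.s (t - 1)) (p.δ (t - 1)) := by
  obtain ⟨t, rfl⟩ := Nat.exists_eq_add_of_le' h1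
  rcases Nat.eq_zero_or_pos t with rfl | ht
  · simpa [h.s_zero, h.δ_zero, h.V_one] using qpFeasible_zero_one D
  · obtain ⟨-, j, hj, -⟩ := h.improve t ht (by omega)
    rw [hj]
    exact (h.sol t ht (by omega)).1.1.on_fourPieces j

lemma Succeeds.δ_le_prev (h : Succeeds D ζ ρ p) {t : ℕ} (h1 : 1 ≤ t) (hN : t ≤ p.N) :
    p.δ t ≤ p.δ (t - 1) := by
  rcases hN.eq_or_lt with rfl | hlt
  · exact h.2.1
  · exact h.1.no_restart t h1 hlt

lemma Succeeds.δ_le_one (h : Succeeds D ζ ρ p) {t : ℕ} (hN : t ≤ p.N) : p.δ t ≤ 1 := by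
  induction t with
  | zero => exact h.1.δ_zero.le
  | succ t ih => exact (h.δ_le_prev (by omega) hN).trans (ih (by omega))

/-- The objective decreases strictly from one piece to the next, so no piece is visited twice. -/
lemma IsPass.N_le (h : IsPass D ρ p) (hB : D.B.PosDef) (hρ : 0 < ρ) :
    p.N ≤ Fintype.card (Set V) := by
  have hstep : ∀ t, 1 ≤ t → t < p.N →
      QPObj D ρ (p.s (t + 1)) (p.δ (t + 1)) < QPObj D ρ (p.s t) (p.δ t) := by
    intro t h1 hN
    by_contra! hle
    have := (h.sol (t + 1) (by omega) (by omega)).1.unique hB hρ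
      (h.feasible_prev (t := t + 1) (by omega) (by omega)) hle
    exact (h.improve t h1 hN).1 this.symm
  have hanti : ∀ t t', 1 ≤ t → t < t' → t' ≤ p.N →
      QPObj D ρ (p.s t') (p.δ t') < QPObj D ρ (p.s t) (p.δ t) := by
    intro t t' h1 hlt
    induction t', hlt using Nat.le_induction with
    | base => exact fun hN => hstep t h1 hN
    | succ t' hle ih =>
      exact fun hN => (hstep t' (by omega) (by omega)).trans (ih (by omega))
  have hne : ∀ t t', 1 ≤ t → t < t' → t' ≤ p.N → p.V₁ t ≠ p.V₁ t' := by
    intro t t' h1 hlt hN heq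
    have e := (h.sol t h1 (by omega)).1.2 (p.s t') (p.δ t')
      (heq ▸ (h.sol t' (by omega) hN).1.1)
    exact absurd (hanti t t' h1 hlt hN) (not_lt.2 e)
  have hinj : Function.Injective fun t : Fin p.N => p.V₁ (t + 1) := by
    intro a b hab
    rcases lt_trichotomy a b with hlt | rfl | hlt
    · exact absurd hab (hne _ _ (by omega) (by simpa using hlt) (by omega))
    · rfl
    · exact absurd hab.symm (hne _ _ (by omega) (by simpa using hlt) (by omega))
  simpa using Fintype.card_le_of_injective _ hinj

end Pass

/-! ### Descent of the model along the auxiliary iterates -/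

section Model

variable {n : ℕ} {E I V : Type*}

lemma abs_h_le_tildeH (p : PassData n E I V) {t : ℕ} (ht : t ∈ Set.Icc 1 p.N) (i : E) :
    |(p.lam t).h i| ≤ tildeH p i :=
  le_csSup ((Set.finite_Icc _ _).image _).bddAbove ⟨t, ht, rfl⟩

lemma abs_g_le_tildeG (p : PassData n E I V) {t : ℕ} (ht : t ∈ Set.Icc 1 p.N) (i : I) :
    |(p.lam t).g i| ≤ tildeG p i :=
  le_csSup ((Set.finite_Icc _ _).image _).bddAbove ⟨t, ht, rfl⟩

lemma abs_HG_le_tildeF (p : PassData n E I V) {t : ℕ} (ht : t ∈ Set.Icc 1 p.N) (i : V) :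
    max |(p.lam t).H i| |(p.lam t).G i| ≤ tildeF p i :=
  le_csSup ((Set.finite_Icc _ _).image _).bddAbove ⟨t, ht, rfl⟩

lemma tildeH_nonneg (p : PassData n E I V) (i : E) : 0 ≤ tildeH p i :=
  Real.sSup_nonneg (by rintro _ ⟨t, -, rfl⟩; positivity)

lemma tildeG_nonneg (p : PassData n E I V) (i : I) : 0 ≤ tildeG p i :=
  Real.sSup_nonneg (by rintro _ ⟨t, -, rfl⟩; positivity)

lemma tildeF_nonneg (p : PassData n E I V) (i : V) : 0 ≤ tildeF p i :=
  Real.sSup_nonneg (by rintro _ ⟨t, -, rfl⟩; positivity)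

/-- The penalty parameters majorize all multipliers of the auxiliary problems. -/
def PenDominates (σ : Pen E I V) (p : PassData n E I V) : Prop :=
  (∀ i, tildeH p i ≤ σ.h i) ∧ (∀ i, tildeG p i ≤ σ.g i) ∧ (∀ i, tildeF p i ≤ σ.F i)

/-- Nonnegativity of all penalty parameters. -/
def PenNonneg (σ : Pen E I V) : Prop :=
  (∀ i, 0 ≤ σ.h i) ∧ (∀ i, 0 ≤ σ.g i) ∧ (∀ i, 0 ≤ σ.F i)

lemma PenDominates.nonneg {σ : Pen E I V} {p : PassData n E I V} (h : PenDominates σ p) :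
    PenNonneg σ :=
  ⟨fun i => (tildeH_nonneg p i).trans (h.1 i), fun i => (tildeG_nonneg p i).trans (h.2.1 i),
    fun i => (tildeF_nonneg p i).trans (h.2.2 i)⟩

variable [Fintype E] [Fintype I] [Fintype V] (M : Problem n E I V)

/-- The weighted constraint violation at `x`, so that `Phi = f + penalty`. -/
noncomputable def penalty (σ : Pen E I V) (x : Vec n) : ℝ :=
  ∑ i, σ.h i * |M.h i x| + ∑ i, σ.g i * max 0 (M.g i x) + ∑ i, σ.F i * dist1 (F M i x) P

/-- The quadratic model of `f` at `x` plus `δ` times the constraint violation at `x`. Unlike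
`phiHatW` it does not depend on the current piece. -/
noncomputable def elasticModel (σ : Pen E I V) (B : Matrix (Fin n) (Fin n) ℝ) (x s : Vec n)
    (δ : ℝ) : ℝ :=
  M.f x + fderiv ℝ M.f x s + 1 / 2 * bil B s s + δ * penalty M σ x

variable {M} {σ : Pen E I V} {B : Matrix (Fin n) (Fin n) ℝ} {x : Vec n} {W : Set V}

lemma Phi_eq : Phi M σ x = M.f x + penalty M σ x := by
  rw [Phi, penalty]; ring

lemma elasticModel_zero_one : elasticModel M σ B x 0 1 = Phi M σ x := by
  rw [elasticModel, Phi_eq]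
  simp [bil]

lemma penalty_nonneg (hσ : PenNonneg σ) : 0 ≤ penalty M σ x := by
  refine add_nonneg (add_nonneg ?_ ?_) ?_ <;> refine Finset.sum_nonneg fun i _ => ?_
  · exact mul_nonneg (hσ.1 i) (abs_nonneg _)
  · exact mul_nonneg (hσ.2.1 i) (le_max_left _ _)
  · exact mul_nonneg (hσ.2.2 i) (dist1_P_nonneg _)

lemma Phi_le_phiW (hσ : PenNonneg σ) : Phi M σ x ≤ phiW M σ W x := by
  rw [Phi, phiW]
  gcongr with i
  · exact hσ.2.2 i
  · exact dist1_P_le_PW _ _ _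

lemma phiHatW_le_elasticModel (hσ : PenNonneg σ) {s : Vec n} {δ : ℝ}
    (h : QPFeasible (auxData M B x) W s δ) :
    phiHatW M σ B W x s ≤ elasticModel M σ B x s δ := by
  have e1 : ∑ i, σ.h i * |M.h i x + fderiv ℝ (M.h i) x s| ≤ δ * ∑ i, σ.h i * |M.h i x| := by
    rw [Finset.mul_sum]
    refine Finset.sum_le_sum fun i _ => ?_
    exact (mul_le_mul_of_nonneg_left (h.abs_lin_h i).le (hσ.1 i)).trans_eq (mul_left_comm _ _ _)
  have e2 : ∑ i, σ.g i * max 0 (M.g i x + fderiv ℝ (M.g i) x s)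
      ≤ δ * ∑ i, σ.g i * max 0 (M.g i x) := by
    rw [Finset.mul_sum]
    refine Finset.sum_le_sum fun i _ => ?_
    exact (mul_le_mul_of_nonneg_left (h.max_lin_g i) (hσ.2.1 i)).trans_eq (mul_left_comm _ _ _)
  have e3 : ∑ i, σ.F i * dist1 (F M i x + dF M i x s) (PW W i)
      ≤ δ * ∑ i, σ.F i * dist1 (F M i x) P := by
    rw [Finset.mul_sum]
    refine Finset.sum_le_sum fun i _ => ?_
    exact (mul_le_mul_of_nonneg_left (h.dist1_lin i) (hσ.2.2 i)).trans_eq (mul_left_comm _ _ _)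
  rw [phiHatW, elasticModel, penalty]
  linarith

/-- The merit function of every piece that contains `(0, δ)`, `δ ≤ 1`, agrees with `Phi` at the
base point. -/
lemma phiW_eq_Phi (hσ : PenNonneg σ) {δ : ℝ} (h : QPFeasible (auxData M B x) W 0 δ)
    (hδ : δ ≤ 1) : phiW M σ W x = Phi M σ x := by
  refine le_antisymm ?_ (Phi_le_phiW hσ)
  have h1 := phiHatW_le_elasticModel hσ h
  have h2 : phiHatW M σ B W x 0 = phiW M σ W x := by
    simp [phiHatW, phiW, bil, dF, ← Prod.zero_eq_mk]
  rw [← h2]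
  refine h1.trans ?_
  rw [elasticModel, Phi_eq]
  have := mul_le_mul_of_nonneg_right hδ (penalty_nonneg (M := M) (x := x) hσ)
  simp [bil]
  linarith

/-- Only the stationarity of the Lagrangian with respect to `s` enters here: testing it with
`s' - s`, the linearized constraints turn the multiplier terms into multiples of `δ' - δ`, which
the penalty parameters majorize. -/
lemma elasticModel_descent (hB : B.IsHermitian) {ρ : ℝ} {s s' : Vec n} {δ δ' : ℝ}
    {m : Mult E I V} (hm : QPMultiplier (auxData M B x) ρ W s δ m)
    (h : QPFeasible (auxData M B x) W s δ) (h' : QPFeasible (auxData M B x) W s' δ')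
    (hδ : δ ≤ δ') (hh : ∀ i, |m.h i| ≤ σ.h i) (hg : ∀ i, |m.g i| ≤ σ.g i)
    (hF : ∀ i, max |m.H i| |m.G i| ≤ σ.F i) :
    elasticModel M σ B x s δ + 1 / 2 * bil B (s' - s) (s' - s)
      ≤ elasticModel M σ B x s' δ' := by
  have hd : 0 ≤ δ' - δ := sub_nonneg.2 hδ
  have e1 : ∑ i, m.h i * fderiv ℝ (M.h i) x (s' - s)
      ≤ (δ' - δ) * ∑ i, σ.h i * |M.h i x| := by
    rw [Finset.mul_sum]
    refine Finset.sum_le_sum fun i _ => ?_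
    have a1 : (1 - δ) * M.h i x + fderiv ℝ (M.h i) x s = 0 := h.1 i
    have a2 : (1 - δ') * M.h i x + fderiv ℝ (M.h i) x s' = 0 := h'.1 i
    rw [map_sub, show fderiv ℝ (M.h i) x s' - fderiv ℝ (M.h i) x s = (δ' - δ) * M.h i x by
      linarith, mul_left_comm]
    refine mul_le_mul_of_nonneg_left ((le_abs_self _).trans ?_) hd
    rw [abs_mul]
    exact mul_le_mul_of_nonneg_right (hh i) (abs_nonneg _)
  have e2 : ∑ i, m.g i * fderiv ℝ (M.g i) x (s' - s)
      ≤ (δ' - δ) * ∑ i, σ.g i * max 0 (M.g i x) := by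
    rw [Finset.mul_sum]
    refine Finset.sum_le_sum fun i _ => ?_
    obtain ⟨a1, a0⟩ := hm.2.2.1 i
    have a2 := mul_nonpos_of_nonneg_of_nonpos a0 (h'.2.1 i)
    have a3 : m.g i * max 0 (M.g i x) ≤ σ.g i * max 0 (M.g i x) :=
      mul_le_mul_of_nonneg_right ((le_abs_self _).trans (hg i)) (le_max_left _ _)
    have a4 := mul_le_mul_of_nonneg_left a3 hd
    have a5 : thetaG (auxData M B x) i * M.g i x = max 0 (M.g i x) := thetaG_mul _ i
    rw [← a5] at a4 ⊢
    simp only [auxData] at a1 a2 a4 ⊢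
    rw [map_sub]
    linarith
  have e3 : ∑ i, (-(m.H i * fderiv ℝ (M.H i) x (s' - s)) + m.G i * fderiv ℝ (M.G i) x (s' - s))
      ≤ (δ' - δ) * ∑ i, σ.F i * dist1 (F M i x) P := by
    rw [Finset.mul_sum]
    refine Finset.sum_le_sum fun i _ => ?_
    have a1 := (hm.2.2.2 i).2 _ (h'.2.2.1 i)
    simp only [linF_fst, linF_snd] at a1
    set u := shiftF (auxData M B x) i
    have a2 : |u.1| + |u.2| = dist1 (F M i x) P := abs_shiftF (auxData M B x) i
    have a3 : -(m.H i * u.1 + m.G i * u.2) ≤ σ.F i * dist1 (F M i x) P := by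
      rw [← a2, mul_add]
      have b1 : -(m.H i * u.1) ≤ σ.F i * |u.1| := by
        refine (neg_le_abs _).trans ?_
        rw [abs_mul]
        exact mul_le_mul_of_nonneg_right ((le_max_left _ _).trans (hF i)) (abs_nonneg _)
      have b2 : -(m.G i * u.2) ≤ σ.F i * |u.2| := by
        refine (neg_le_abs _).trans ?_
        rw [abs_mul]
        exact mul_le_mul_of_nonneg_right ((le_max_right _ _).trans (hF i)) (abs_nonneg _)
      linarith
    have a4 := mul_le_mul_of_nonneg_left a3 hd
    simp only [auxData] at a1
    rw [map_sub, map_sub]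
    linarith
  have e0 := hm.1 (s' - s)
  simp only [auxData] at e0
  have e4 : bil B s' s' = bil B s s + 2 * bil B (s' - s) s + bil B (s' - s) (s' - s) := by
    conv_lhs => rw [← sub_add_cancel s' s]
    simp only [bil_add_left, bil_add_right, bil_comm hB s (s' - s)]
    ring
  have e5 : fderiv ℝ M.f x (s' - s) = fderiv ℝ M.f x s' - fderiv ℝ M.f x s := map_sub _ _ _
  rw [elasticModel, elasticModel, penalty]
  linarith

lemma phiHatW_combo_le (hσ : PenNonneg σ) (hB : B.PosDef) {α : ℝ} (h0 : 0 ≤ α) (h1 : α ≤ 1)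
    (s s' : Vec n) :
    phiHatW M σ B W x ((1 - α) • s + α • s')
      ≤ (1 - α) * phiHatW M σ B W x s + α * phiHatW M σ B W x s' := by
  have h1' : 0 ≤ 1 - α := by linarith
  have e0 : bil B ((1 - α) • s + α • s') ((1 - α) • s + α • s')
      ≤ (1 - α) * bil B s s + α * bil B s' s' := by
    rw [bil_combo hB.isHermitian]
    have := mul_nonneg (mul_nonneg h0 h1') (bil_self_nonneg hB (s' - s))
    linarith
  have e1 : ∑ i, σ.h i * |M.h i x + fderiv ℝ (M.h i) x ((1 - α) • s + α • s')|
      ≤ (1 - α) * ∑ i, σ.h i * |M.h i x + fderiv ℝ (M.h i) x s|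
        + α * ∑ i, σ.h i * |M.h i x + fderiv ℝ (M.h i) x s'| := by
    rw [Finset.mul_sum, Finset.mul_sum, ← Finset.sum_add_distrib]
    refine Finset.sum_le_sum fun i _ => ?_
    have := mul_le_mul_of_nonneg_left (abs_combo_le h0 h1 (M.h i x + fderiv ℝ (M.h i) x s)
      (M.h i x + fderiv ℝ (M.h i) x s')) (hσ.1 i)
    rw [map_add, map_smul, map_smul, smul_eq_mul, smul_eq_mul]
    convert this using 1
    · congr 2; ring
    · ring
  have e2 : ∑ i, σ.g i * max 0 (M.g i x + fderiv ℝ (M.g i) x ((1 - α) • s + α • s'))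
      ≤ (1 - α) * ∑ i, σ.g i * max 0 (M.g i x + fderiv ℝ (M.g i) x s)
        + α * ∑ i, σ.g i * max 0 (M.g i x + fderiv ℝ (M.g i) x s') := by
    rw [Finset.mul_sum, Finset.mul_sum, ← Finset.sum_add_distrib]
    refine Finset.sum_le_sum fun i _ => ?_
    have := mul_le_mul_of_nonneg_left (max_zero_combo_le h0 h1 (M.g i x + fderiv ℝ (M.g i) x s)
      (M.g i x + fderiv ℝ (M.g i) x s')) (hσ.2.1 i)
    rw [map_add, map_smul, map_smul, smul_eq_mul, smul_eq_mul]
    convert this using 1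
    · congr 2; ring
    · ring
  have e3 : ∑ i, σ.F i * dist1 (F M i x + dF M i x ((1 - α) • s + α • s')) (PW W i)
      ≤ (1 - α) * ∑ i, σ.F i * dist1 (F M i x + dF M i x s) (PW W i)
        + α * ∑ i, σ.F i * dist1 (F M i x + dF M i x s') (PW W i) := by
    rw [Finset.mul_sum, Finset.mul_sum, ← Finset.sum_add_distrib]
    refine Finset.sum_le_sum fun i _ => ?_
    have := mul_le_mul_of_nonneg_left (dist1_PW_combo_le W i h0 h1 (F M i x + dF M i x s)
      (F M i x + dF M i x s')) (hσ.2.2 i)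
    have hlin : F M i x + dF M i x ((1 - α) • s + α • s')
        = (1 - α) • (F M i x + dF M i x s) + α • (F M i x + dF M i x s') := by
      ext <;> simp [dF, F] <;> ring
    rw [hlin]
    convert this using 1
    ring
  have e4 : fderiv ℝ M.f x ((1 - α) • s + α • s')
      = (1 - α) * fderiv ℝ M.f x s + α * fderiv ℝ M.f x s' := by simp
  simp only [phiHatW]
  linarith

end Model

/-! ### Uniform first order expansion of the merit function -/

section Taylor

variable {n : ℕ}

/-- The first order Taylor expansion of a `C¹` function is uniform on balls. -/
lemma eventually_abs_taylor_le {c : Vec n → ℝ} (hc : ContDiff ℝ 1 c) (R : ℝ) {ε : ℝ}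
    (hε : 0 < ε) :
    ∀ᶠ s in 𝓝 (0 : Vec n), ∀ x, ‖x‖ ≤ R → |c (x + s) - c x - fderiv ℝ c x s| ≤ ε * ‖s‖ := by
  have hK : IsCompact (Metric.closedBall (0 : Vec n) (R + 1)) := isCompact_closedBall _ _
  have hu := hK.uniformContinuousOn_of_continuous (hc.continuous_fderiv one_ne_zero).continuousOn
  rw [Metric.uniformContinuousOn_iff] at hu
  obtain ⟨r, hr, hu⟩ := hu ε hε
  filter_upwards [Metric.ball_mem_nhds (0 : Vec n) (lt_min hr one_pos)] with s hs x hx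
  rw [mem_ball_zero_iff, lt_min_iff] at hs
  have hd : ∀ y ∈ segment ℝ x (x + s), ‖fderiv ℝ c y - fderiv ℝ c x‖ ≤ ε := by
    intro y hy
    have hyx : ‖y - x‖ ≤ ‖s‖ := by
      have := (convex_closedBall x ‖s‖).segment_subset
        (Metric.mem_closedBall_self (norm_nonneg _)) (by simp) hy
      rwa [mem_closedBall_iff_norm] at this
    rw [← dist_eq_norm]
    refine (hu y ?_ x ?_ ?_).le
    · rw [mem_closedBall_zero_iff]
      have := norm_add_le (y - x) x
      rw [sub_add_cancel] at this
      linarith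
    · rw [mem_closedBall_zero_iff]; linarith
    · rw [dist_eq_norm]; linarith
  have := (convex_segment x (x + s)).norm_image_sub_le_of_norm_fderiv_le'
    (fun y _ => (hc.differentiable one_ne_zero) y) hd (left_mem_segment ℝ x (x + s))
    (right_mem_segment ℝ x (x + s))
  simpa using this

variable {E I V : Type*} [Fintype E] [Fintype I] [Fintype V] (M : Problem n E I V)

lemma eventually_phiW_add_le {σ : Pen E I V} (hσ : PenNonneg σ) (R : ℝ) {ε : ℝ} (hε : 0 < ε) :
    ∀ᶠ s in 𝓝 (0 : Vec n), ∀ x, ‖x‖ ≤ R → ∀ W,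
      phiW M σ W (x + s) ≤ phiHatW M σ 0 W x s + ε * ‖s‖ := by
  set L : ℝ := 1 + ∑ i, σ.h i + ∑ i, σ.g i + ∑ i, σ.F i * 2 with hL
  have hL0 : 0 < L := by
    have e1 := Finset.sum_nonneg fun i (_ : i ∈ Finset.univ) => hσ.1 i
    have e2 := Finset.sum_nonneg fun i (_ : i ∈ Finset.univ) => hσ.2.1 i
    have e3 : 0 ≤ ∑ i, σ.F i * 2 :=
      Finset.sum_nonneg fun i _ => mul_nonneg (hσ.2.2 i) zero_le_two
    linarith
  have hη : 0 < ε / L := div_pos hε hL0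
  filter_upwards [eventually_abs_taylor_le M.f_smooth R hη,
    eventually_all.2 fun i => eventually_abs_taylor_le (M.h_smooth i) R hη,
    eventually_all.2 fun i => eventually_abs_taylor_le (M.g_smooth i) R hη,
    eventually_all.2 fun i => eventually_abs_taylor_le (M.G_smooth i) R hη,
    eventually_all.2 fun i => eventually_abs_taylor_le (M.H_smooth i) R hη]
    with s hf hh hg hG hH x hx W
  set η := ε / L * ‖s‖ with hηs
  have e0 : M.f (x + s) ≤ M.f x + fderiv ℝ M.f x s + η := by
    linarith [(abs_le.1 (hf x hx)).2]
  have e1 : ∑ i, σ.h i * |M.h i (x + s)|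
      ≤ ∑ i, σ.h i * |M.h i x + fderiv ℝ (M.h i) x s| + (∑ i, σ.h i) * η := by
    rw [Finset.sum_mul, ← Finset.sum_add_distrib]
    refine Finset.sum_le_sum fun i _ => ?_
    rw [← mul_add]
    refine mul_le_mul_of_nonneg_left ?_ (hσ.1 i)
    have := abs_sub_abs_le_abs_sub (M.h i (x + s)) (M.h i x + fderiv ℝ (M.h i) x s)
    rw [← sub_sub] at this
    linarith [hh i x hx]
  have e2 : ∑ i, σ.g i * max 0 (M.g i (x + s))
      ≤ ∑ i, σ.g i * max 0 (M.g i x + fderiv ℝ (M.g i) x s) + (∑ i, σ.g i) * η := by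
    rw [Finset.sum_mul, ← Finset.sum_add_distrib]
    refine Finset.sum_le_sum fun i _ => ?_
    rw [← mul_add]
    refine mul_le_mul_of_nonneg_left (max_le (by positivity) ?_) (hσ.2.1 i)
    linarith [(abs_le.1 (hg i x hx)).2, le_max_right 0 (M.g i x + fderiv ℝ (M.g i) x s)]
  have e3 : ∑ i, σ.F i * dist1 (F M i (x + s)) (PW W i)
      ≤ ∑ i, σ.F i * dist1 (F M i x + dF M i x s) (PW W i) + (∑ i, σ.F i * 2) * η := by
    rw [Finset.sum_mul, ← Finset.sum_add_distrib]
    refine Finset.sum_le_sum fun i _ => ?_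
    rw [mul_assoc, ← mul_add]
    refine mul_le_mul_of_nonneg_left ?_ (hσ.2.2 i)
    refine (dist1_PW_le_add W i _ (F M i x + dF M i x s)).trans (add_le_add_right ?_ _)
    have a1 := hH i x hx
    have a2 := hG i x hx
    have b1 : |(F M i (x + s)).1 - (F M i x + dF M i x s).1|
        = |M.H i (x + s) - M.H i x - fderiv ℝ (M.H i) x s| := by
      rw [← abs_neg]; simp [F, dF]; congr 1; ring
    have b2 : |(F M i (x + s)).2 - (F M i x + dF M i x s).2|
        = |M.G i (x + s) - M.G i x - fderiv ℝ (M.G i) x s| := by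
      simp [F, dF, sub_sub]
    rw [b1, b2]
    linarith
  have e4 : L * η = ε * ‖s‖ := by rw [hηs]; field_simp
  have e5 : bil (0 : Matrix (Fin n) (Fin n) ℝ) s s = 0 := by simp [bil]
  rw [phiW, phiHatW, ← e4, e5, hL]
  linarith

end Taylor

/-! ### The polygonal line through the auxiliary iterates -/

section Path

variable {n : ℕ} {E I V : Type*} (p : PassData n E I V)

lemma lenS_eq_prev_add {t : ℕ} (ht : 1 ≤ t) :
    lenS p t = lenS p (t - 1) + ‖p.s t - p.s (t - 1)‖ := by
  obtain ⟨t, rfl⟩ := Nat.exists_eq_add_of_le' ht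
  simp [lenS, Finset.sum_range_succ]

lemma lenS_mono : Monotone (lenS p) :=
  monotone_nat_of_le_succ fun t => by
    rw [lenS_eq_prev_add p (t := t + 1) (by omega)]
    simp

lemma lenS_zero : lenS p 0 = 0 := by simp [lenS]

lemma lenS_nonneg (t : ℕ) : 0 ≤ lenS p t := by
  rw [← lenS_zero p]; exact lenS_mono p (Nat.zero_le t)

variable {p}

lemma norm_s_le_lenS (h0 : p.s 0 = 0) (t : ℕ) : ‖p.s t‖ ≤ lenS p t := by
  induction t with
  | zero => simp [h0, lenS_zero]
  | succ t ih =>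
    rw [lenS_eq_prev_add p (t := t + 1) (by omega)]
    have := norm_add_le (p.s t) (p.s (t + 1) - p.s t)
    rw [add_sub_cancel] at this
    simp only [Nat.add_sub_cancel]
    linarith

lemma tIdx_mem_Icc (hN : 1 ≤ p.N) (hS : 0 < lenS p p.N) {γ : ℝ} (h0 : 0 ≤ γ) (h1 : γ ≤ 1) :
    1 ≤ tIdx p γ ∧ tIdx p γ ≤ p.N := by
  unfold tIdx
  split_ifs with h
  · exact ⟨hN, le_rfl⟩
  · have hmem : p.N ∈ {t | γ * lenS p p.N < lenS p t} := by
      have : γ < 1 := lt_of_le_of_ne h1 h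
      change γ * lenS p p.N < lenS p p.N
      nlinarith
    refine ⟨?_, Nat.sInf_le hmem⟩
    by_contra! hlt
    have h2 : γ * lenS p p.N < lenS p (sInf {t | γ * lenS p p.N < lenS p t}) :=
      Nat.sInf_mem ⟨_, hmem⟩
    rw [Nat.lt_one_iff.1 hlt, lenS_zero] at h2
    nlinarith

lemma lenS_prev_tIdx_le (hN : 1 ≤ p.N) (hS : 0 < lenS p p.N) {γ : ℝ} (h0 : 0 ≤ γ)
    (h1 : γ ≤ 1) : lenS p (tIdx p γ - 1) ≤ γ * lenS p p.N := by
  have hI := tIdx_mem_Icc hN hS h0 h1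
  by_cases h : γ = 1
  · rw [h, one_mul]
    exact lenS_mono p (by rw [h] at hI; omega)
  · by_contra! hlt
    have : tIdx p γ ≤ tIdx p γ - 1 := by
      conv_lhs => rw [tIdx, if_neg h]
      exact Nat.sInf_le hlt
    omega

lemma le_lenS_tIdx (hS : 0 < lenS p p.N) {γ : ℝ} (h1 : γ ≤ 1) :
    γ * lenS p p.N ≤ lenS p (tIdx p γ) := by
  by_cases h : γ = 1
  · rw [tIdx, if_pos h, h, one_mul]
  · rw [tIdx, if_neg h]
    have hmem : p.N ∈ {t | γ * lenS p p.N < lenS p t} := by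
      have : γ < 1 := lt_of_le_of_ne h1 h
      change γ * lenS p p.N < lenS p p.N
      nlinarith
    exact (Nat.sInf_mem (s := {t | γ * lenS p p.N < lenS p t}) ⟨_, hmem⟩).le

lemma alphaPar_mul_norm (hN : 1 ≤ p.N) (hS : 0 < lenS p p.N) {γ : ℝ} (h0 : 0 ≤ γ)
    (h1 : γ ≤ 1) :
    alphaPar p γ * ‖p.s (tIdx p γ) - p.s (tIdx p γ - 1)‖
      = γ * lenS p p.N - lenS p (tIdx p γ - 1) := by
  have hI := tIdx_mem_Icc hN hS h0 h1
  have hd := lenS_eq_prev_add p hI.1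
  have hle := lenS_prev_tIdx_le hN hS h0 h1
  have hge := le_lenS_tIdx hS h1
  by_cases h : γ = 1
  · have ht : tIdx p γ = p.N := by rw [tIdx, if_pos h]
    rw [ht] at hd ⊢
    rw [alphaPar, if_pos h, h, hd]
    ring
  · rw [alphaPar, if_neg h, show lenS p (tIdx p γ) - lenS p (tIdx p γ - 1)
      = ‖p.s (tIdx p γ) - p.s (tIdx p γ - 1)‖ by linarith]
    refine div_mul_cancel_of_imp fun hz => ?_
    linarith

lemma alphaPar_mem_Icc (hN : 1 ≤ p.N) (hS : 0 < lenS p p.N) {γ : ℝ} (h0 : 0 ≤ γ)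
    (h1 : γ ≤ 1) : 0 ≤ alphaPar p γ ∧ alphaPar p γ ≤ 1 := by
  have hd := lenS_eq_prev_add p (tIdx_mem_Icc hN hS h0 h1).1
  have hle := lenS_prev_tIdx_le hN hS h0 h1
  have hge := le_lenS_tIdx hS h1
  have hm := lenS_mono p (Nat.sub_le (tIdx p γ) 1)
  unfold alphaPar
  split_ifs with h
  · simp
  · exact ⟨div_nonneg (by linarith) (by linarith), div_le_one_of_le₀ (by linarith) (by linarith)⟩

lemma norm_sHat_le (h0s : p.s 0 = 0) (hN : 1 ≤ p.N) (hS : 0 < lenS p p.N) {γ : ℝ} (h0 : 0 ≤ γ)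
    (h1 : γ ≤ 1) : ‖sHat p γ‖ ≤ γ * lenS p p.N := by
  have e1 := norm_add_le (p.s (tIdx p γ - 1))
    (alphaPar p γ • (p.s (tIdx p γ) - p.s (tIdx p γ - 1)))
  rw [norm_smul, Real.norm_of_nonneg (alphaPar_mem_Icc hN hS h0 h1).1,
    alphaPar_mul_norm hN hS h0 h1] at e1
  have := norm_s_le_lenS h0s (tIdx p γ - 1)
  rw [sHat]
  linarith

lemma sHat_eq_segPoint (γ : ℝ) : sHat p γ = segPoint p (tIdx p γ) (alphaPar p γ) := by
  rw [sHat, segPoint, smul_sub, sub_smul, one_smul]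
  abel

lemma le_tIdx (hS : 0 < lenS p p.N) {γ : ℝ} (h1 : γ ≤ 1) {t : ℕ} (ht : 1 ≤ t)
    (h : lenS p (t - 1) < γ * lenS p p.N) : t ≤ tIdx p γ := by
  by_contra! hlt
  have := lenS_mono p (show tIdx p γ ≤ t - 1 by omega)
  linarith [le_lenS_tIdx hS h1]

end Path

/-! ### Geometric sequences of trial steps -/

/-- Trial steps as used in both line searches: they start at `1` and the ratios of successive
steps lie between `lo` and `hi`. -/
structure IsTrialSeq (lo hi : ℝ) (a : ℕ → ℝ) : Prop where
  lo_pos : 0 < lo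
  hi_lt_one : hi < 1
  zero : a 0 = 1
  ratio : ∀ j, lo ≤ a (j + 1) / a j ∧ a (j + 1) / a j ≤ hi

namespace IsTrialSeq

variable {lo hi : ℝ} {a : ℕ → ℝ}

lemma pos (h : IsTrialSeq lo hi a) (j : ℕ) : 0 < a j := by
  induction j with
  | zero => rw [h.zero]; exact one_pos
  | succ j ih => exact (div_pos_iff_of_pos_right ih).1 (h.lo_pos.trans_le (h.ratio j).1)

lemma lo_mul_le (h : IsTrialSeq lo hi a) (j : ℕ) : lo * a j ≤ a (j + 1) :=
  (le_div_iff₀ (h.pos j)).1 (h.ratio j).1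

lemma le_hi_mul (h : IsTrialSeq lo hi a) (j : ℕ) : a (j + 1) ≤ hi * a j :=
  (div_le_iff₀ (h.pos j)).1 (h.ratio j).2

lemma antitone (h : IsTrialSeq lo hi a) : Antitone a :=
  antitone_nat_of_succ_le fun j => by nlinarith [h.le_hi_mul j, h.pos j, h.hi_lt_one]

lemma le_one (h : IsTrialSeq lo hi a) (j : ℕ) : a j ≤ 1 := by
  rw [← h.zero]; exact h.antitone (Nat.zero_le j)

/-- Some trial step falls into any prescribed window `[lo * b, b]`. -/
lemma exists_mem_window (h : IsTrialSeq lo hi a) {b : ℝ} (hb0 : 0 < b) (hb1 : b ≤ 1) :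
    ∃ j, lo * b ≤ a j ∧ a j ≤ b := by
  have hlohi : lo ≤ hi := (h.ratio 0).1.trans (h.ratio 0).2
  have hhi : 0 ≤ hi := h.lo_pos.le.trans hlohi
  have hpow : ∀ j, a j ≤ hi ^ j := fun j => by
    induction j with
    | zero => simp [h.zero]
    | succ j ih =>
      rw [pow_succ']
      exact (h.le_hi_mul j).trans (mul_le_mul_of_nonneg_left ih hhi)
  have hex : ∃ j, a j ≤ b := by
    obtain ⟨j, hj⟩ := exists_pow_lt_of_lt_one hb0 h.hi_lt_one
    exact ⟨j, (hpow j).trans hj.le⟩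
  classical
  refine ⟨Nat.find hex, ?_, Nat.find_spec hex⟩
  rcases Nat.eq_zero_or_pos (Nat.find hex) with h0 | h0
  · rw [h0, h.zero]
    have := h.lo_pos
    have := h.hi_lt_one
    nlinarith
  · obtain ⟨j, hj⟩ := Nat.exists_eq_add_of_le' h0
    have hlt : b < a j := not_le.1 (Nat.find_min hex (by omega))
    rw [hj]
    exact (mul_le_mul_of_nonneg_left hlt.le h.lo_pos.le).trans (h.lo_mul_le j)

end IsTrialSeq

/-! ### Decrease of the merit function in the line search -/

section LineSearchDecrease

variable {n : ℕ} {E I V : Type*} [Fintype E] [Fintype I] [Fintype V]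

/-- The situation of one line search: `p` is a successful run of the auxiliary procedure at `x`
with a nonzero final step, `σ` majorizes its multipliers, `B` is uniformly positive definite with
constant `c`, and `j` is the accepted index in the sequence `γ` of trial parameters. -/
structure IsLineSearch (M : Problem n E I V) (A : Params) (σ : Pen E I V) (c : ℝ) (x : Vec n)
    (B : Matrix (Fin n) (Fin n) ℝ) (p : PassData n E I V) (γ : ℕ → ℝ) (j : ℕ) : Prop where
  posDef : B.PosDef
  coercive : ∀ u : Vec n, c * ‖u‖ ^ 2 ≤ bil B u u
  succeeds : ∃ ρ, 0 < ρ ∧ Succeeds (auxData M B x) A.ζ ρ p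
  s_ne_zero : p.s p.N ≠ 0
  dominates : PenDominates σ p
  trial : IsTrialSeq A.γlo A.γhi γ
  least : IsLeast {j | lsY p M σ x (γ j) - lsY p M σ x 0
    ≤ A.ξ * (lsZ p M σ B x (γ j) - lsZ p M σ B x 0)} j

namespace IsLineSearch

variable {M : Problem n E I V} {A : Params} {σ : Pen E I V} {c : ℝ} {x : Vec n}
  {B : Matrix (Fin n) (Fin n) ℝ} {p : PassData n E I V} {γ : ℕ → ℝ} {j : ℕ}

lemma one_le (h : IsLineSearch M A σ c x B p γ j) : 1 ≤ p.N := by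
  obtain ⟨ρ, -, hs⟩ := h.succeeds
  exact hs.1.one_le

lemma s_zero (h : IsLineSearch M A σ c x B p γ j) : p.s 0 = 0 := by
  obtain ⟨ρ, -, hs⟩ := h.succeeds
  exact hs.1.s_zero

lemma lenS_pos (h : IsLineSearch M A σ c x B p γ j) : 0 < lenS p p.N :=
  (norm_pos_iff.2 h.s_ne_zero).trans_le (norm_s_le_lenS h.s_zero _)

lemma N_le (h : IsLineSearch M A σ c x B p γ j) : p.N ≤ Fintype.card (Set V) := by
  obtain ⟨ρ, hρ, hs⟩ := h.succeeds
  exact hs.1.N_le h.posDef hρ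

lemma elasticModel_step (h : IsLineSearch M A σ c x B p γ j) {t : ℕ} (h1 : 1 ≤ t)
    (hN : t ≤ p.N) :
    elasticModel M σ B x (p.s t) (p.δ t) + c / 2 * ‖p.s t - p.s (t - 1)‖ ^ 2
      ≤ elasticModel M σ B x (p.s (t - 1)) (p.δ (t - 1)) := by
  obtain ⟨ρ, -, hs⟩ := h.succeeds
  obtain ⟨hsol, hmul⟩ := hs.1.sol t h1 hN
  have ht : t ∈ Set.Icc 1 p.N := ⟨h1, hN⟩
  have hd := elasticModel_descent (σ := σ) h.posDef.isHermitian hmul hsol.1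
    (hs.1.feasible_prev h1 hN) (hs.δ_le_prev h1 hN)
    (fun i => (abs_h_le_tildeH p ht i).trans (h.dominates.1 i))
    (fun i => (abs_g_le_tildeG p ht i).trans (h.dominates.2.1 i))
    (fun i => (abs_HG_le_tildeF p ht i).trans (h.dominates.2.2 i))
  have hc := h.coercive (p.s (t - 1) - p.s t)
  rw [norm_sub_rev] at hc
  linarith

lemma elasticModel_anti (h : IsLineSearch M A σ c x B p γ j) (hc : 0 ≤ c) {t t' : ℕ}
    (htt : t ≤ t') (hN : t' ≤ p.N) :
    elasticModel M σ B x (p.s t') (p.δ t') ≤ elasticModel M σ B x (p.s t) (p.δ t) := by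
  induction t', htt using Nat.le_induction with
  | base => exact le_rfl
  | succ t' hle ih =>
    have := h.elasticModel_step (t := t' + 1) (by omega) hN
    simp only [Nat.add_sub_cancel] at this
    have h2 : 0 ≤ c / 2 * ‖p.s (t' + 1) - p.s t'‖ ^ 2 := by positivity
    linarith [ih (by omega)]

lemma elasticModel_zero (h : IsLineSearch M A σ c x B p γ j) :
    elasticModel M σ B x (p.s 0) (p.δ 0) = Phi M σ x := by
  obtain ⟨ρ, -, hs⟩ := h.succeeds
  rw [hs.1.s_zero, hs.1.δ_zero, elasticModel_zero_one]

lemma s_prev_tIdx_zero (h : IsLineSearch M A σ c x B p γ j) : p.s (tIdx p 0 - 1) = 0 := by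
  have h1 := lenS_prev_tIdx_le h.one_le h.lenS_pos le_rfl zero_le_one
  rw [zero_mul] at h1
  exact norm_le_zero_iff.1 ((norm_s_le_lenS h.s_zero _).trans h1)

lemma alphaPar_zero (h : IsLineSearch M A σ c x B p γ j) : alphaPar p 0 = 0 := by
  have h1 := lenS_prev_tIdx_le h.one_le h.lenS_pos le_rfl zero_le_one
  rw [zero_mul] at h1
  have h2 := le_antisymm h1 (lenS_nonneg p _)
  rw [alphaPar, if_neg zero_ne_one, h2]
  simp

lemma phiW_tIdx_zero (h : IsLineSearch M A σ c x B p γ j) :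
    phiW M σ (p.V₁ (tIdx p 0)) x = Phi M σ x := by
  obtain ⟨ρ, -, hs⟩ := h.succeeds
  obtain ⟨h1, hN⟩ := tIdx_mem_Icc h.one_le h.lenS_pos le_rfl zero_le_one
  have hf := hs.1.feasible_prev h1 hN
  rw [h.s_prev_tIdx_zero] at hf
  exact phiW_eq_Phi h.dominates.nonneg hf (hs.δ_le_one (by omega))

lemma lsY_zero (h : IsLineSearch M A σ c x B p γ j) : lsY p M σ x 0 = Phi M σ x := by
  rw [lsY, phiT, segPoint, h.alphaPar_zero, h.s_prev_tIdx_zero]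
  simpa using h.phiW_tIdx_zero

lemma lsZ_zero (h : IsLineSearch M A σ c x B p γ j) : lsZ p M σ B x 0 = Phi M σ x := by
  rw [lsZ, phiHatT, segPoint, h.alphaPar_zero, h.s_prev_tIdx_zero, ← h.phiW_tIdx_zero]
  simp [phiHatW, phiW, bil, dF, ← Prod.zero_eq_mk]

lemma lsZ_le_elasticModel (h : IsLineSearch M A σ c x B p γ j) {g : ℝ} (h0 : 0 ≤ g)
    (h1 : g ≤ 1) :
    lsZ p M σ B x g
      ≤ (1 - alphaPar p g)
          * elasticModel M σ B x (p.s (tIdx p g - 1)) (p.δ (tIdx p g - 1))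
        + alphaPar p g * elasticModel M σ B x (p.s (tIdx p g)) (p.δ (tIdx p g)) := by
  obtain ⟨ρ, -, hs⟩ := h.succeeds
  obtain ⟨ht1, htN⟩ := tIdx_mem_Icc h.one_le h.lenS_pos h0 h1
  obtain ⟨ha0, ha1⟩ := alphaPar_mem_Icc h.one_le h.lenS_pos h0 h1
  have e0 := phiHatW_le_elasticModel h.dominates.nonneg (hs.1.feasible_prev ht1 htN)
  have e1 := phiHatW_le_elasticModel h.dominates.nonneg (hs.1.sol _ ht1 htN).1.1
  have s0 : segPoint p (tIdx p g) 0 = p.s (tIdx p g - 1) := by simp [segPoint]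
  have s1 : segPoint p (tIdx p g) 1 = p.s (tIdx p g) := by simp [segPoint]
  rw [lsZ, phiHatT, phiHatT, s0, s1]
  exact add_le_add (mul_le_mul_of_nonneg_left e0 (by linarith))
    (mul_le_mul_of_nonneg_left e1 ha0)

/-- If the polygonal line has reached the segment number `t` well before the parameter `g`, then
the model has decreased by an amount that is linear in the length covered in this segment. -/
lemma lsZ_le (h : IsLineSearch M A σ c x B p γ j) (hc : 0 ≤ c) {g : ℝ} (h0 : 0 < g)
    (h1 : g ≤ 1) {t : ℕ} (ht1 : 1 ≤ t) (htN : t ≤ p.N)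
    (hlen : lenS p (t - 1) ≤ g * lenS p p.N / 2) :
    lsZ p M σ B x g - lsZ p M σ B x 0
      ≤ -(c / 2 * (‖p.s t - p.s (t - 1)‖ *
          min ‖p.s t - p.s (t - 1)‖ (g * lenS p p.N / 2))) := by
  have hS := h.lenS_pos
  have hgS : 0 < g * lenS p p.N := mul_pos h0 hS
  obtain ⟨hT1, hTN⟩ := tIdx_mem_Icc h.one_le hS h0.le h1
  obtain ⟨ha0, ha1⟩ := alphaPar_mem_Icc h.one_le hS h0.le h1
  have hZ := h.lsZ_le_elasticModel h0.le h1
  have hα := alphaPar_mul_norm h.one_le hS h0.le h1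
  have htT : t ≤ tIdx p g := le_tIdx hS h1 ht1 (by linarith)
  have hm0 := h.elasticModel_anti hc (Nat.zero_le (t - 1)) (by omega)
  have hstep := h.elasticModel_step ht1 htN
  have hstepT := h.elasticModel_step hT1 hTN
  rw [h.elasticModel_zero] at hm0
  rw [h.lsZ_zero]
  set T := tIdx p g
  set a := alphaPar p g
  set r := ‖p.s t - p.s (t - 1)‖ with hr
  have hr0 : 0 ≤ r := norm_nonneg _
  rcases htT.eq_or_lt with heq | hlt
  · rw [← heq] at hZ hα
    have hmin : min r (g * lenS p p.N / 2) ≤ a * r := by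
      rw [← hr] at hα
      refine (min_le_right _ _).trans ?_
      rw [hα]; linarith
    have e1 := mul_le_mul_of_nonneg_left hstep ha0
    have e2 : c / 2 * (r * min r (g * lenS p p.N / 2)) ≤ c / 2 * (r * (a * r)) :=
      mul_le_mul_of_nonneg_left (mul_le_mul_of_nonneg_left hmin hr0) (by positivity)
    linarith
  · have e1 := h.elasticModel_anti hc (show t ≤ T - 1 by omega) (by omega)
    have e2 := mul_le_mul_of_nonneg_left hstepT ha0
    have e3 : 0 ≤ a * (c / 2 * ‖p.s T - p.s (T - 1)‖ ^ 2) := by positivity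
    have e4 : c / 2 * (r * min r (g * lenS p p.N / 2)) ≤ c / 2 * (r * r) :=
      mul_le_mul_of_nonneg_left (mul_le_mul_of_nonneg_left (min_le_left _ _) hr0)
        (by positivity)
    linarith

/-- The merit function along the polygonal line differs from its model by the Taylor remainder;
the quadratic term of the model only helps. -/
lemma lsY_le (h : IsLineSearch M A σ c x B p γ j) {g ε : ℝ} (h0 : 0 ≤ g) (h1 : g ≤ 1)
    (hε : 0 ≤ ε)
    (hT : ∀ W, phiW M σ W (x + sHat p g) ≤ phiHatW M σ 0 W x (sHat p g) + ε * ‖sHat p g‖) :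
    lsY p M σ x g ≤ lsZ p M σ B x g + ε * (g * lenS p p.N) := by
  have e1 := hT (p.V₁ (tIdx p g))
  obtain ⟨ha0, ha1⟩ := alphaPar_mem_Icc h.one_le h.lenS_pos h0 h1
  have e2 := phiHatW_combo_le (M := M) (x := x) (W := p.V₁ (tIdx p g)) h.dominates.nonneg
    h.posDef ha0 ha1 (p.s (tIdx p g - 1)) (p.s (tIdx p g))
  have e3 : phiHatW M σ 0 (p.V₁ (tIdx p g)) x (sHat p g)
      ≤ phiHatW M σ B (p.V₁ (tIdx p g)) x (sHat p g) := by
    have hb := bil_self_nonneg h.posDef (sHat p g)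
    have hz : bil (0 : Matrix (Fin n) (Fin n) ℝ) (sHat p g) (sHat p g) = 0 := by simp [bil]
    simp only [phiHatW, hz]
    linarith
  have e4 := mul_le_mul_of_nonneg_left (norm_sHat_le h.s_zero h.one_le h.lenS_pos h0 h1) hε
  have s0 : segPoint p (tIdx p g) 0 = p.s (tIdx p g - 1) := by simp [segPoint]
  have s1 : segPoint p (tIdx p g) 1 = p.s (tIdx p g) := by simp [segPoint]
  rw [sHat_eq_segPoint] at e1 e3 e4
  rw [lsY, lsZ, phiT, phiHatT, phiHatT, s0, s1]
  change phiHatW M σ B _ x (segPoint p (tIdx p g) (alphaPar p g)) ≤ _ at e2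
  linarith

lemma Phi_next_le (h : IsLineSearch M A σ c x B p γ j) :
    Phi M σ (x + sHat p (γ j))
      ≤ Phi M σ x + A.ξ * (lsZ p M σ B x (γ j) - lsZ p M σ B x 0) := by
  have e1 := h.least.1
  rw [Set.mem_ofPred_eq, h.lsY_zero] at e1
  have e2 : Phi M σ (x + sHat p (γ j)) ≤ lsY p M σ x (γ j) := by
    rw [lsY, phiT, sHat_eq_segPoint]
    exact Phi_le_phiW h.dominates.nonneg
  linarith

lemma Phi_next_le_Phi (h : IsLineSearch M A σ c x B p γ j) (hc : 0 ≤ c) :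
    Phi M σ (x + sHat p (γ j)) ≤ Phi M σ x := by
  have hγ := h.trial.pos j
  have hS := h.lenS_pos
  have e := h.lsZ_le hc hγ (h.trial.le_one j) le_rfl h.one_le
    (by simp only [Nat.sub_self, lenS_zero]; positivity)
  have e1 : 0 ≤ c / 2 * (‖p.s 1 - p.s (1 - 1)‖ *
          min ‖p.s 1 - p.s (1 - 1)‖ (γ j * lenS p p.N / 2)) := by positivity
  have := mul_nonpos_of_nonneg_of_nonpos A.hξ.1.le (e.trans (neg_nonpos.2 e1))
  linarith [h.Phi_next_le]

end IsLineSearch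

/-- A uniform decrease of the merit function whenever the `t`-th auxiliary step has length at
least `ε`. Induction on `t`: either an earlier step is not small, or the polygonal line reaches the
`t`-th segment almost immediately, and then the decrease of the model is linear in the arc length
on a fixed window `[γlo b, b]`, where it dominates the Taylor remainder. -/
lemma exists_decrease_of_step (M : Problem n E I V) (A : Params) {σ : Pen E I V}
    (hσ : PenNonneg σ) {c : ℝ} (hc : 0 < c) (R : ℝ) (t : ℕ) :
    ∀ ε > 0, ∃ κ > 0, ∀ (x : Vec n) (B : Matrix (Fin n) (Fin n) ℝ) (p : PassData n E I V)
      (γ : ℕ → ℝ) (j : ℕ), ‖x‖ ≤ R → IsLineSearch M A σ c x B p γ j → 1 ≤ t → t ≤ p.N →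
      ε ≤ ‖p.s t - p.s (t - 1)‖ → Phi M σ (x + sHat p (γ j)) ≤ Phi M σ x - κ := by
  induction t using Nat.strong_induction_on with
  | _ t ih =>
  intro ε hε
  obtain ⟨hξ0, hξ1⟩ := A.hξ
  have hγlo := A.hγ.1
  set ε₁ : ℝ := (1 - A.ξ) * (c / 4 * ε) with hε₁
  have hε₁0 : 0 < ε₁ := by have := sub_pos.2 hξ1; positivity
  obtain ⟨r, hr, hball⟩ := Metric.eventually_nhds_iff.1 (eventually_phiW_add_le M hσ R hε₁0)
  set b : ℝ := min (r / 2) (ε / 2) with hb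
  have hb0 : 0 < b := by positivity
  set η : ℝ := A.γlo * b / (2 * (t + 1)) with hη
  have hη0 : 0 < η := by positivity
  choose! κ hκ0 hκ using fun τ (hτ : τ < t) => ih τ hτ η hη0
  set κ₀ : ℝ := A.ξ * (c / 2 * (ε * min ε (A.γlo * b / 2))) with hκ₀
  have hκ₀0 : 0 < κ₀ := by positivity
  obtain ⟨κ₁, hκ₁0, hκ₁⟩ : ∃ κ₁ > 0, κ₁ ≤ κ₀ ∧ ∀ τ < t, κ₁ ≤ κ τ := by
    have hne : (insert κ₀ ((Finset.range t).image κ)).Nonempty := Finset.insert_nonempty _ _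
    refine ⟨(insert κ₀ ((Finset.range t).image κ)).min' hne, ?_, Finset.min'_le _ _ (by simp),
      fun τ hτ => Finset.min'_le _ _ (Finset.mem_insert_of_mem
        (Finset.mem_image_of_mem κ (Finset.mem_range.2 hτ)))⟩
    rw [gt_iff_lt, Finset.lt_min'_iff]
    intro y hy
    rcases Finset.mem_insert.1 hy with rfl | hy
    · exact hκ₀0
    · obtain ⟨τ, hτ, rfl⟩ := Finset.mem_image.1 hy
      exact hκ0 τ (Finset.mem_range.1 hτ)
  refine ⟨κ₁, hκ₁0, fun x B p γ j hx h ht1 htN hstep => ?_⟩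
  by_cases hex : ∃ τ, 1 ≤ τ ∧ τ < t ∧ η ≤ ‖p.s τ - p.s (τ - 1)‖
  · obtain ⟨τ, hτ1, hτt, hτ⟩ := hex
    have := hκ τ hτt x B p γ j hx h hτ1 (by omega) hτ
    linarith [hκ₁.2 τ hτt]
  push Not at hex
  have hS := h.lenS_pos
  -- all earlier steps are short, so the `t`-th segment starts at arc length at most `γlo b / 2`
  have hshort : lenS p (t - 1) ≤ A.γlo * b / 2 := by
    have h1 : lenS p (t - 1) ≤ ∑ _τ ∈ Finset.range (t - 1), η :=
      Finset.sum_le_sum fun τ hτ => by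
        have := hex (τ + 1) (by omega) (by have := Finset.mem_range.1 hτ; omega)
        simpa using this.le
    rw [Finset.sum_const, Finset.card_range, nsmul_eq_mul] at h1
    have h2 : ((t - 1 : ℕ) : ℝ) * η ≤ (t + 1) * η := by
      refine mul_le_mul_of_nonneg_right ?_ hη0.le
      have : ((t - 1 : ℕ) : ℝ) ≤ t := by exact_mod_cast Nat.sub_le t 1
      linarith
    have h3 : (t + 1 : ℝ) * η = A.γlo * b / 2 := by
      rw [hη]; field_simp
    linarith
  have hSε : ε ≤ lenS p p.N := by
    have := lenS_eq_prev_add p ht1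
    linarith [lenS_mono p htN, lenS_nonneg p (t - 1)]
  -- a trial parameter whose arc length lies in the window satisfies the acceptance condition
  obtain ⟨i, hi1, hi2⟩ := h.trial.exists_mem_window (b := b / lenS p p.N) (by positivity)
    ((div_le_one hS).2 ((min_le_right _ _).trans (by linarith)))
  have hi1' : A.γlo * b ≤ γ i * lenS p p.N := by
    rw [← mul_div_assoc, div_le_iff₀ hS] at hi1; exact hi1
  have hi2' : γ i * lenS p p.N ≤ b := (le_div_iff₀ hS).1 hi2
  have hγi := h.trial.pos i
  have hγi1 := h.trial.le_one i
  have hacc : lsY p M σ x (γ i) - lsY p M σ x 0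
      ≤ A.ξ * (lsZ p M σ B x (γ i) - lsZ p M σ B x 0) := by
    have e1 := h.lsZ_le hc.le hγi hγi1 ht1 htN (by linarith)
    have hmin : γ i * lenS p p.N / 2 ≤ ‖p.s t - p.s (t - 1)‖ := by
      linarith [min_le_right (r / 2) (ε / 2)]
    rw [min_eq_right hmin] at e1
    have hnorm := norm_sHat_le h.s_zero h.one_le hS hγi.le hγi1
    have e2 := h.lsY_le hγi.le hγi1 hε₁0.le (hball (y := sHat p (γ i)) (by
      rw [dist_zero_right]; linarith [min_le_left (r / 2) (ε / 2)]) x hx)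
    have e3 : c / 4 * ε * (γ i * lenS p p.N)
        ≤ c / 2 * (‖p.s t - p.s (t - 1)‖ * (γ i * lenS p p.N / 2)) := by
      have := mul_le_mul_of_nonneg_right hstep (mul_pos hγi hS).le
      nlinarith
    have e4 : (1 - A.ξ) * (lsZ p M σ B x (γ i) - lsZ p M σ B x 0)
        ≤ (1 - A.ξ) * -(c / 4 * ε * (γ i * lenS p p.N)) :=
      mul_le_mul_of_nonneg_left (by linarith) (by linarith)
    rw [h.lsY_zero]
    rw [h.lsZ_zero] at e4 ⊢
    rw [hε₁] at e2
    linarith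
  -- hence the accepted parameter is at least as large, and the model has decreased accordingly
  have hji : γ i ≤ γ j := h.trial.antitone (h.least.2 hacc)
  have hj := mul_le_mul_of_nonneg_right hji hS.le
  have e1 := h.lsZ_le hc.le (h.trial.pos j) (h.trial.le_one j) ht1 htN (by linarith)
  have e2 : ε * min ε (A.γlo * b / 2)
      ≤ ‖p.s t - p.s (t - 1)‖ * min ‖p.s t - p.s (t - 1)‖ (γ j * lenS p p.N / 2) :=
    mul_le_mul hstep (min_le_min hstep (by linarith)) (by positivity) (norm_nonneg _)
  have e3 : A.ξ * (lsZ p M σ B x (γ j) - lsZ p M σ B x 0) ≤ -κ₀ := by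
    rw [hκ₀, ← mul_neg]
    refine mul_le_mul_of_nonneg_left (e1.trans (neg_le_neg ?_)) hξ0.le
    exact mul_le_mul_of_nonneg_left e2 (by positivity)
  linarith [h.Phi_next_le, hκ₁.1]

/-- A uniform decrease of the merit function whenever the polygonal line is not short; the number
of auxiliary steps is bounded by the number of pieces. -/
lemma exists_decrease_of_lenS (M : Problem n E I V) (A : Params) {σ : Pen E I V}
    (hσ : PenNonneg σ) {c : ℝ} (hc : 0 < c) (R : ℝ) {ε : ℝ} (hε : 0 < ε) :
    ∃ κ > 0, ∀ (x : Vec n) (B : Matrix (Fin n) (Fin n) ℝ) (p : PassData n E I V)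
      (γ : ℕ → ℝ) (j : ℕ), ‖x‖ ≤ R → IsLineSearch M A σ c x B p γ j →
      ε ≤ lenS p p.N → Phi M σ (x + sHat p (γ j)) ≤ Phi M σ x - κ := by
  set m := Fintype.card (Set V)
  have hm : (0 : ℝ) < m := by exact_mod_cast Fintype.card_pos
  choose κ hκ0 hκ using fun t =>
    exists_decrease_of_step M A hσ hc R t (ε / m) (div_pos hε hm)
  have hne : ((Finset.range (m + 1)).image κ).Nonempty := by simp
  refine ⟨((Finset.range (m + 1)).image κ).min' hne, ?_, fun x B p γ j hx h hS => ?_⟩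
  · rw [gt_iff_lt, Finset.lt_min'_iff]
    intro y hy
    obtain ⟨τ, -, rfl⟩ := Finset.mem_image.1 hy
    exact hκ0 τ
  · obtain ⟨t, htN, ht⟩ : ∃ t < p.N, ε / m ≤ ‖p.s (t + 1) - p.s t‖ := by
      by_contra! hlt
      have h1 : lenS p p.N < ∑ _t ∈ Finset.range p.N, ε / m :=
        Finset.sum_lt_sum_of_nonempty ⟨0, Finset.mem_range.2 h.one_le⟩
          fun t ht => hlt t (Finset.mem_range.1 ht)
      rw [Finset.sum_const, Finset.card_range, nsmul_eq_mul] at h1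
      have h2 : (p.N : ℝ) * (ε / m) ≤ m * (ε / m) :=
        mul_le_mul_of_nonneg_right (by exact_mod_cast h.N_le) (by positivity)
      rw [mul_div_cancel₀ _ hm.ne'] at h2
      linarith
    have h1 := hκ (t + 1) x B p γ j hx h (by omega) htN (by simpa using ht)
    have h2 : ((Finset.range (m + 1)).image κ).min' hne ≤ κ (t + 1) :=
      Finset.min'_le _ _ (Finset.mem_image_of_mem κ (Finset.mem_range.2 (by
        have := h.N_le; omega)))
    linarith

end LineSearchDecrease

/-! ### The penalty parameters are eventually constant -/

section Penalty

variable {ξ₁ ξ₂ : ℝ} {a l : ℕ → ℝ}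

lemma updatePen_pos (h1 : 1 < ξ₁) (h2 : ξ₁ < ξ₂) (h0 : 0 < a 0)
    (ha : ∀ k, a (k + 1) = updatePen ξ₁ ξ₂ (a k) (l k)) (k : ℕ) : 0 < a k := by
  induction k with
  | zero => exact h0
  | succ k ih =>
    rw [ha, updatePen]
    split_ifs with h
    · have hl : 0 < l k := by by_contra! hl; nlinarith
      nlinarith
    · exact ih

lemma le_updatePen (h1 : 1 < ξ₁) (h2 : ξ₁ < ξ₂) {a l : ℝ} (hl : 0 ≤ l) :
    l ≤ updatePen ξ₁ ξ₂ a l := by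
  unfold updatePen
  split_ifs with h <;> nlinarith

/-- Every change of a penalty parameter multiplies it by at least `ξ₂ / ξ₁ > 1`, which can happen
only finitely often when the multipliers are bounded. -/
lemma exists_eventually_eq_of_updatePen (h1 : 1 < ξ₁) (h2 : ξ₁ < ξ₂) (h0 : 0 < a 0)
    (ha : ∀ k, a (k + 1) = updatePen ξ₁ ξ₂ (a k) (l k)) {C : ℝ} (hC : ∀ k, l k ≤ C) :
    ∃ b, ∀ᶠ k in atTop, a k = b := by
  have hpos := updatePen_pos h1 h2 h0 ha
  have hξ : 0 < ξ₁ := by linarith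
  have hq : 0 < ξ₂ / ξ₁ - 1 := by rw [sub_pos, one_lt_div hξ]; exact h2
  have hstep : ∀ k, a (k + 1) = a k ∨ a k + (ξ₂ / ξ₁ - 1) * a k ≤ a (k + 1) := fun k => by
    rw [ha, updatePen]
    split_ifs with h
    · right
      have : ξ₂ / ξ₁ * a k ≤ ξ₂ / ξ₁ * (ξ₁ * l k) :=
        mul_le_mul_of_nonneg_left h.le (by linarith)
      rw [← mul_assoc, div_mul_cancel₀ _ hξ.ne'] at this
      linarith
    · exact Or.inl rfl
  have hmono : Monotone a := monotone_nat_of_le_succ fun k => by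
    rcases hstep k with h | h
    · exact h.ge
    · have := mul_pos hq (hpos k)
      linarith
  have hbdd : BddAbove (Set.range a) := by
    refine ⟨max (a 0) (ξ₂ * C), ?_⟩
    rintro _ ⟨k, rfl⟩
    induction k with
    | zero => exact le_max_left _ _
    | succ k ih =>
      rw [ha, updatePen]
      split_ifs
      · exact (mul_le_mul_of_nonneg_left (hC k) (by linarith)).trans (le_max_right _ _)
      · exact ih
  have hlim := tendsto_atTop_ciSup hmono hbdd
  have hdiff : Tendsto (fun k => a (k + 1) - a k) atTop (𝓝 0) := by
    simpa using ((tendsto_add_atTop_iff_nat 1).2 hlim).sub hlim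
  obtain ⟨K, hK⟩ := eventually_atTop.1
    (hdiff.eventually (gt_mem_nhds (mul_pos hq h0)))
  refine ⟨a K, eventually_atTop.2 ⟨K, fun k hk => ?_⟩⟩
  induction k, hk using Nat.le_induction with
  | base => rfl
  | succ k hk ih =>
    rcases hstep k with h | h
    · rw [h, ih]
    · have := hK k hk
      have := mul_le_mul_of_nonneg_left (hmono (Nat.zero_le k)) hq.le
      linarith

end Penalty

/-! ### Limits along sequences of base points -/

section Basic

variable {n : ℕ} {E I V : Type*} {M : Problem n E I V}

lemma continuous_dist1_P (i : V) : Continuous fun x => dist1 (F M i x) P := by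
  simp only [dist1_P, F]
  have h1 := (M.H_smooth i).continuous
  have h2 := (M.G_smooth i).continuous
  fun_prop

lemma continuous_dist1_PW (W : Set V) (i : V) : Continuous fun x => dist1 (F M i x) (PW W i) := by
  have h1 := (M.H_smooth i).continuous
  have h2 := (M.G_smooth i).continuous
  by_cases hi : i ∈ W
  · simp only [dist1_PW_of_mem hi, F]
    fun_prop
  · simp only [dist1_PW_of_notMem hi, F]
    fun_prop

lemma LPFeasible.norm_le {x d : Vec n} {W : Set V} (h : LPFeasible M x W d) :
    ‖d‖ ≤ √n := by
  rw [EuclideanSpace.norm_eq]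
  refine Real.sqrt_le_sqrt ?_
  calc ∑ j, ‖d j‖ ^ 2 ≤ ∑ _j : Fin n, (1 : ℝ) := Finset.sum_le_sum fun j _ => by
        rw [Real.norm_eq_abs, sq_abs, sq_le_one_iff_abs_le_one, abs_le]
        exact h.2.2.2.2 j
    _ = n := by simp

lemma tendsto_fderiv_apply {c : Vec n → ℝ} (hc : ContDiff ℝ 1 c) {ι : Type*} {l : Filter ι}
    {y s : ι → Vec n} {x v : Vec n} (hy : Tendsto y l (𝓝 x)) (hs : Tendsto s l (𝓝 v)) :
    Tendsto (fun k => fderiv ℝ c (y k) (s k)) l (𝓝 (fderiv ℝ c x v)) := by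
  have h1 : Tendsto (fun k => fderiv ℝ c (y k)) l (𝓝 (fderiv ℝ c x)) :=
    ((hc.continuous_fderiv one_ne_zero).tendsto x).comp hy
  exact ((isBoundedBilinearMap_apply (𝕜 := ℝ)).continuous.tendsto (fderiv ℝ c x, v)).comp
    (h1.prodMk_nhds hs)

/-- Feasibility passes to the limit of base points at which the auxiliary problem has ever shorter
final steps with `δ` bounded away from `1`. -/
lemma feasible_of_tendsto_of_qpFeasible {ι : Type*} {l : Filter ι} [l.NeBot] {y s : ι → Vec n}
    {B : ι → Matrix (Fin n) (Fin n) ℝ} {W : ι → Set V} {δ : ι → ℝ} {ζ : ℝ} (hζ : ζ < 1)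
    {x : Vec n} (hy : Tendsto y l (𝓝 x)) (hs : Tendsto s l (𝓝 0))
    (hf : ∀ᶠ k in l, QPFeasible (auxData M (B k) (y k)) (W k) (s k) (δ k) ∧ δ k < ζ) :
    Feasible M x := by
  have hζ' : 0 < 1 - ζ := sub_pos.2 hζ
  have hder : ∀ {c : Vec n → ℝ}, ContDiff ℝ 1 c →
      Tendsto (fun k => |fderiv ℝ c (y k) (s k)|) l (𝓝 0) := fun {c} hc => by
    simpa using (tendsto_fderiv_apply hc hy hs).abs
  have hlim : ∀ {q : Vec n → ℝ} {e : ι → ℝ}, Continuous q → Tendsto e l (𝓝 0) →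
      (∀ᶠ k in l, (1 - ζ) * q (y k) ≤ e k) → q x ≤ 0 := fun {q e} hq he hle => by
    have h1 := ((hq.tendsto x).comp hy).const_mul (1 - ζ)
    have := le_of_tendsto_of_tendsto h1 he hle
    by_contra! hpos
    linarith [mul_pos hζ' hpos]
  refine ⟨fun i => ?_, fun i => ?_, fun i => ?_⟩
  · refine abs_nonpos_iff.1 (hlim (M.h_smooth i).continuous.abs (hder (M.h_smooth i)) ?_)
    filter_upwards [hf] with k ⟨hk, hδ⟩
    have h1 : (1 - δ k) * M.h i (y k) + fderiv ℝ (M.h i) (y k) (s k) = 0 := hk.1 i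
    rw [← abs_neg (fderiv ℝ (M.h i) (y k) (s k)), ← eq_neg_of_add_eq_zero_left h1, abs_mul,
      abs_of_nonneg (by linarith : 0 ≤ 1 - δ k)]
    exact mul_le_mul_of_nonneg_right (by linarith) (abs_nonneg _)
  · refine (le_max_right 0 _).trans
      (hlim (continuous_const.max (M.g_smooth i).continuous) (hder (M.g_smooth i)) ?_)
    filter_upwards [hf] with k ⟨hk, hδ⟩
    have h1 := hk.2.1 i
    have h2 := thetaG_mul (auxData M (B k) (y k)) i
    have h3 := neg_le_abs (fderiv ℝ (M.g i) (y k) (s k))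
    rcases le_total (M.g i (y k)) 0 with hg | hg
    · rw [max_eq_left hg]; simp
    · simp only [auxData] at h1 h2
      rw [max_eq_right hg] at h2 ⊢
      nlinarith
  · have hd := hlim (continuous_dist1_P i)
      (by simpa using (hder (M.H_smooth i)).add (hder (M.G_smooth i))) (by
        filter_upwards [hf] with k ⟨hk, hδ⟩
        refine le_trans ?_ (hk.dist1_le (hδ.trans hζ) i)
        exact mul_le_mul_of_nonneg_right (by linarith) (dist1_P_nonneg _))
    have hP : F M i x ∈ P := dist1_P_eq_zero.1 (le_antisymm hd (dist1_P_nonneg _))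
    have h1 : -M.H i x ≤ 0 := hP.1
    have h2 : 0 ≤ -M.H i x * M.G i x := hP.2
    constructor <;> linarith

end Basic

/-! ### Consequences of the monotonicity of the merit function -/

section Run

variable {n : ℕ} {E I V : Type*} [Fintype E] [Fintype I] [Fintype V] {M : Problem n E I V}
  {A : Params} {T : Trace n E I V}

lemma IsInfiniteRun.σprev_succ (hrun : IsInfiniteRun M A T) (k : ℕ) :
    T.σprev (k + 1) = newPen A.ξ₁ A.ξ₂ (T.σprev k) (T.pass k) :=
  hrun.σ_update k

lemma IsInfiniteRun.penDominates (hrun : IsInfiniteRun M A T) (k : ℕ) :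
    PenDominates (T.σ k) (T.pass k) := by
  obtain ⟨h1, h2⟩ := A.hξ₁₂
  rw [hrun.σ_update k]
  exact ⟨fun i => le_updatePen h1 h2 (tildeH_nonneg _ _),
    fun i => le_updatePen h1 h2 (tildeG_nonneg _ _),
    fun i => le_updatePen h1 h2 (tildeF_nonneg _ _)⟩

lemma IsInfiniteRun.exists_eventually_σ_eq (hrun : IsInfiniteRun M A T)
    (hbdd : BoundednessAssumption T) :
    ∃ σ : Pen E I V, ∀ᶠ k in atTop, T.σ k = σ ∧ T.σcorr k = σ := by
  obtain ⟨⟨Cx, Cs, Cl, hC⟩, -⟩ := hbdd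
  obtain ⟨h1, h2⟩ := A.hξ₁₂
  choose bh hbh using fun i => exists_eventually_eq_of_updatePen
    (a := fun k => (T.σprev k).h i) h1 h2 (hrun.σinit_pos.1 i)
    (fun k => by simp only [hrun.σprev_succ]; rfl) (fun k => (hC k).2.2.1 i)
  choose bg hbg using fun i => exists_eventually_eq_of_updatePen
    (a := fun k => (T.σprev k).g i) h1 h2 (hrun.σinit_pos.2.1 i)
    (fun k => by simp only [hrun.σprev_succ]; rfl) (fun k => (hC k).2.2.2.1 i)
  choose bF hbF using fun i => exists_eventually_eq_of_updatePen
    (a := fun k => (T.σprev k).F i) h1 h2 (hrun.σinit_pos.2.2 i)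
    (fun k => by simp only [hrun.σprev_succ]; rfl) (fun k => (hC k).2.2.2.2 i)
  have hprev : ∀ᶠ k in atTop, T.σprev k = ⟨bh, bg, bF⟩ := by
    filter_upwards [eventually_all.2 hbh, eventually_all.2 hbg, eventually_all.2 hbF]
      with k e1 e2 e3
    rw [← funext e1, ← funext e2, ← funext e3]
  refine ⟨⟨bh, bg, bF⟩, ?_⟩
  filter_upwards [hprev, (tendsto_add_atTop_nat 1).eventually hprev] with k e1 e2
  have e2 : T.σ k = ⟨bh, bg, bF⟩ := e2
  exact ⟨e2, (hrun.σcorr_eq k).elim (fun h => h.trans e2) (fun h => h.trans e1)⟩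

lemma IsInfiniteRun.ρ_pos (hrun : IsInfiniteRun M A T) (k : ℕ) : 0 < T.ρ k := by
  induction k with
  | zero => exact hrun.ρ_zero
  | succ k ih =>
    obtain ⟨r, hr, -⟩ := hrun.aux k
    have := A.hρbar
    rw [hr]; positivity

lemma IsInfiniteRun.trialSeq_γ (hrun : IsInfiniteRun M A T) (k : ℕ) :
    IsTrialSeq A.γlo A.γhi (T.γ k) :=
  ⟨A.hγ.1, A.hγ.2, hrun.γ_zero k, hrun.γ_ratio k⟩

lemma IsInfiniteRun.trialSeq_α (hrun : IsInfiniteRun M A T) (k : ℕ) :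
    IsTrialSeq A.αlo A.αhi (T.α k) :=
  ⟨A.hα.1, A.hα.2, hrun.α_zero k, hrun.α_ratio k⟩

lemma IsInfiniteRun.exists_isLineSearch (hrun : IsInfiniteRun M A T)
    (hbdd : BoundednessAssumption T) :
    ∃ c > 0, ∀ k, ∃ j, IsLineSearch M A (T.σ k) c (T.xt k) (T.B k) (T.pass k) (T.γ k) j ∧
      T.x (k + 1) = T.xt k + sHat (T.pass k) (T.γ k j) := by
  obtain ⟨-, c, CB, hc, hB⟩ := hbdd
  refine ⟨c, hc, fun k => ?_⟩
  obtain ⟨j, hj, hx⟩ := hrun.next k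
  obtain ⟨⟨hH, hev⟩, -⟩ := hB k
  obtain ⟨r, -, -, hs⟩ := hrun.aux k
  exact ⟨j, ⟨hrun.B_posDef k, fun u => bil_self_ge_of_eigenvalues hH hev u,
    ⟨_, hrun.ρ_pos (k + 1), hs⟩, hrun.s_ne_zero k, hrun.penDominates k, hrun.trialSeq_γ k, hj⟩,
    hx⟩

lemma IsInfiniteRun.lpFeasible_d (hrun : IsInfiniteRun M A T) (k : ℕ) :
    LPFeasible M (T.x k) (T.W k) (T.d k) := by
  rcases hrun.d_choice k with ⟨h1, h2, -⟩ | ⟨h1, h2, -⟩ <;> rw [h1, h2]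
  · exact (hrun.d1_sol k).1
  · exact (hrun.d2_sol k).1

lemma IsInfiniteRun.norm_xt_sub_le (hrun : IsInfiniteRun M A T) (k : ℕ) :
    ‖T.xt k - T.x k‖ ≤ √n := by
  by_cases hd : fderiv ℝ M.f (T.x k) (T.d k) < 0
  · obtain ⟨j, -, h1, h2⟩ := hrun.correct k hd
    by_cases hdec : CorrDecrease M A T k (T.α k j)
    · rw [h1 hdec, add_sub_cancel_left, norm_smul,
        Real.norm_of_nonneg ((hrun.trialSeq_α k).pos j).le]
      have := mul_le_mul ((hrun.trialSeq_α k).le_one j) (hrun.lpFeasible_d k).norm_le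
        (norm_nonneg _) zero_le_one
      linarith
    · rw [h2 hdec]; simp
  · rw [hrun.no_correct k hd]; simp

lemma IsInfiniteRun.Phi_xt_le (hrun : IsInfiniteRun M A T) (k : ℕ) :
    Phi M (T.σcorr k) (T.xt k) ≤ Phi M (T.σcorr k) (T.x k) := by
  by_cases hd : fderiv ℝ M.f (T.x k) (T.d k) < 0
  · obtain ⟨j, -, h1, h2⟩ := hrun.correct k hd
    by_cases hdec : CorrDecrease M A T k (T.α k j)
    · rw [h1 hdec]
      have h3 : A.μ * T.α k j * fderiv ℝ M.f (T.x k) (T.d k) ≤ 0 :=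
        mul_nonpos_of_nonneg_of_nonpos
          (mul_nonneg A.hμ.1.le ((hrun.trialSeq_α k).pos j).le) hd.le
      unfold CorrDecrease at hdec
      linarith
    · rw [h2 hdec]
  · rw [hrun.no_correct k hd]

/-- The merit function with the final penalty parameters decreases and stays bounded below, so both
the correction steps and the line searches decrease it by amounts tending to zero; the latter
forces the polygonal lines to become short. -/
lemma IsInfiniteRun.exists_limit_penalty (hrun : IsInfiniteRun M A T)
    (hbdd : BoundednessAssumption T) :
    ∃ σ : Pen E I V, PenNonneg σ ∧ (∀ᶠ k in atTop, T.σcorr k = σ) ∧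
      Tendsto (fun k => Phi M σ (T.x k) - Phi M σ (T.xt k)) atTop (𝓝 0) ∧
      Tendsto (fun k => lenS (T.pass k) (T.pass k).N) atTop (𝓝 0) := by
  obtain ⟨σ, hσ⟩ := hrun.exists_eventually_σ_eq hbdd
  obtain ⟨c, hc, hls⟩ := hrun.exists_isLineSearch hbdd
  choose j hls hnext using hls
  obtain ⟨⟨Cx, Cs, Cl, hC⟩, -⟩ := hbdd
  obtain ⟨K, hK⟩ := eventually_atTop.1 hσ
  have hσ0 : PenNonneg σ := by
    rw [← (hK K le_rfl).1]; exact (hrun.penDominates K).nonneg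
  have hls' : ∀ k ≥ K,
      IsLineSearch M A σ c (T.xt k) (T.B k) (T.pass k) (T.γ k) (j k) := fun k hk => by
    rw [← (hK k hk).1]; exact hls k
  have hcorr : ∀ k ≥ K, Phi M σ (T.xt k) ≤ Phi M σ (T.x k) := fun k hk => by
    rw [← (hK k hk).2]; exact hrun.Phi_xt_le k
  have hline : ∀ k ≥ K, Phi M σ (T.x (k + 1)) ≤ Phi M σ (T.xt k) := fun k hk => by
    rw [hnext k]; exact (hls' k hk).Phi_next_le_Phi hc.le
  have hxt : ∀ k, ‖T.xt k‖ ≤ Cx + √n := fun k => by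
    have := norm_add_le (T.xt k - T.x k) (T.x k)
    rw [sub_add_cancel] at this
    linarith [hrun.norm_xt_sub_le k, (hC k).1]
  obtain ⟨m, hm⟩ : ∃ m, ∀ k, m ≤ Phi M σ (T.x k) := by
    obtain ⟨m, hm⟩ := (isCompact_closedBall (0 : Vec n) Cx).bddBelow_image
      M.f_smooth.continuous.continuousOn
    refine ⟨m, fun k => ?_⟩
    have h1 := hm ⟨T.x k, mem_closedBall_zero_iff.2 (hC k).1, rfl⟩
    rw [Phi_eq]
    linarith [penalty_nonneg (M := M) (x := T.x k) hσ0]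
  have hanti : Antitone fun k => Phi M σ (T.x (k + K)) := antitone_nat_of_succ_le fun k => by
    have := (hline (k + K) (by omega)).trans (hcorr (k + K) (by omega))
    rwa [show k + K + 1 = k + 1 + K by omega] at this
  have hlim := (tendsto_add_atTop_iff_nat (f := fun k => Phi M σ (T.x k)) K).1
    (tendsto_atTop_ciInf hanti ⟨m, by rintro _ ⟨k, rfl⟩; exact hm _⟩)
  have hdiff : Tendsto (fun k => Phi M σ (T.x k) - Phi M σ (T.x (k + 1))) atTop (𝓝 0) := by
    simpa using hlim.sub ((tendsto_add_atTop_iff_nat 1).2 hlim)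
  refine ⟨σ, hσ0, hσ.mono fun k h => h.2, ?_, ?_⟩
  · refine tendsto_of_tendsto_of_tendsto_of_le_of_le' tendsto_const_nhds hdiff ?_ ?_
    · filter_upwards [eventually_ge_atTop K] with k hk
      linarith [hcorr k hk]
    · filter_upwards [eventually_ge_atTop K] with k hk
      linarith [hline k hk]
  · rw [Metric.tendsto_atTop]
    intro ε hε
    obtain ⟨κ, hκ0, hκ⟩ := exists_decrease_of_lenS M A hσ0 hc (Cx + √n) hε
    obtain ⟨K', hK'⟩ := eventually_atTop.1 (hdiff.eventually (gt_mem_nhds hκ0))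
    refine ⟨max K K', fun k hk => ?_⟩
    rw [Real.dist_eq, sub_zero, abs_of_nonneg (lenS_nonneg _ _)]
    by_contra! hge
    have h1 := hκ _ _ _ _ _ (hxt k) (hls' k (le_of_max_le_left hk)) hge
    rw [← hnext k] at h1
    linarith [hK' k (le_of_max_le_right hk), hcorr k (le_of_max_le_left hk)]

/-- A limit point of the iterates is feasible: it is also the limit of the preceding corrected
iterates, at which the auxiliary problem had short final steps. -/
lemma IsInfiniteRun.feasible_of_tendsto (hrun : IsInfiniteRun M A T)
    (hbdd : BoundednessAssumption T) {K : Set ℕ} [NeBot (atTop ⊓ 𝓟 K)] {x : Vec n}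
    (hx : Tendsto T.x (atTop ⊓ 𝓟 K) (𝓝 x)) : Feasible M x := by
  obtain ⟨σ, -, -, -, hS⟩ := hrun.exists_limit_penalty hbdd
  obtain ⟨c, -, hls⟩ := hrun.exists_isLineSearch hbdd
  choose j hls hnext using hls
  have hpred : Tendsto (fun k => k - 1) (atTop ⊓ 𝓟 K) atTop :=
    (tendsto_sub_atTop_nat 1).mono_left inf_le_left
  have hS' := hS.comp hpred
  have hstep : Tendsto (fun k => T.x k - T.xt (k - 1)) (atTop ⊓ 𝓟 K) (𝓝 0) := by
    refine squeeze_zero_norm' ?_ hS'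
    filter_upwards [(eventually_ge_atTop 1).filter_mono inf_le_left] with k hk
    obtain ⟨k, rfl⟩ := Nat.exists_eq_add_of_le' hk
    have h := hls k
    rw [Function.comp_apply, Nat.add_sub_cancel, hnext k, add_sub_cancel_left]
    refine (norm_sHat_le h.s_zero h.one_le h.lenS_pos (h.trial.pos _).le
      (h.trial.le_one _)).trans ?_
    exact mul_le_of_le_one_left h.lenS_pos.le (h.trial.le_one _)
  have hy : Tendsto (fun k => T.xt (k - 1)) (atTop ⊓ 𝓟 K) (𝓝 x) := by
    simpa using hx.sub hstep
  refine feasible_of_tendsto_of_qpFeasible (s := fun k => (T.pass (k - 1)).s (T.pass (k - 1)).N)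
    (B := fun k => T.B (k - 1)) (W := fun k => (T.pass (k - 1)).V₁ (T.pass (k - 1)).N)
    (δ := fun k => (T.pass (k - 1)).δ (T.pass (k - 1)).N) A.hζ.2 hy ?_ ?_
  · exact squeeze_zero_norm (fun k => norm_s_le_lenS (hls (k - 1)).s_zero _) hS'
  · refine Eventually.of_forall fun k => ?_
    obtain ⟨r, -, -, hs⟩ := hrun.aux (k - 1)
    exact ⟨(hs.1.sol _ hs.1.one_le le_rfl).1.1, hs.2.2.2⟩

end Run

/-! ### Stability of the linear programs under perturbation of the base point -/

/-- A common zero of linearly independent functionals can be perturbed to common zeros of nearby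
families: it is corrected by a combination of the Riesz representatives of the limit functionals,
whose coefficients solve a linear system close to the invertible one with the Gram matrix. -/
lemma exists_tendsto_forall_apply_eq_zero {X : Type*} [NormedAddCommGroup X]
    [InnerProductSpace ℝ X] [CompleteSpace X] {ι κ : Type*} [Finite ι] {l : Filter κ}
    {a : ι → X →L[ℝ] ℝ} {A : κ → ι → X →L[ℝ] ℝ} (ha : LinearIndependent ℝ a)
    (hA : ∀ i v, Tendsto (fun k => A k i v) l (𝓝 (a i v))) {d : X} (hd : ∀ i, a i d = 0) :
    ∃ e : κ → X, Tendsto e l (𝓝 d) ∧ ∀ᶠ k in l, ∀ i, A k i (e k) = 0 := by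
  classical
  have := Fintype.ofFinite ι
  set v : ι → X := fun i => (InnerProductSpace.toDual ℝ X).symm (a i)
  have hv : LinearIndependent ℝ v :=
    ha.map' (InnerProductSpace.toDual ℝ X).symm.toLinearEquiv.toLinearMap (LinearEquiv.ker _)
  set G : Matrix ι ι ℝ := fun i j => a i (v j) with hG
  set Q : κ → Matrix ι ι ℝ := fun k i j => A k i (v j) with hQ
  have hGram : G = Matrix.gram ℝ v := by
    ext i j
    rw [Matrix.gram_apply, InnerProductSpace.toDual_symm_apply]
  have hdet : G.det ≠ 0 := by
    rw [hGram]
    exact (Matrix.posDef_gram_of_linearIndependent hv).det_pos.ne'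
  have hQG : Tendsto Q l (𝓝 G) :=
    tendsto_pi_nhds.2 fun i => tendsto_pi_nhds.2 fun j => hA i (v j)
  have hinv : Tendsto (fun k => (Q k)⁻¹) l (𝓝 G⁻¹) :=
    (continuousAt_matrix_inv G (by
      simpa using NormedRing.inverse_continuousAt (Units.mk0 G.det hdet))).tendsto.comp hQG
  have hdetQ : ∀ᶠ k in l, (Q k).det ≠ 0 :=
    (((continuous_id.matrix_det).tendsto G).comp hQG).eventually_ne hdet
  have hc : ∀ j, Tendsto (fun k => ((Q k)⁻¹.mulVec fun i => A k i d) j) l (𝓝 0) := fun j => by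
    have : Tendsto (fun k => ∑ i, (Q k)⁻¹ j i * A k i d) l (𝓝 (∑ i, G⁻¹ j i * a i d)) :=
      tendsto_finsetSum _ fun i _ =>
        ((tendsto_pi_nhds.1 (tendsto_pi_nhds.1 hinv j) i).mul (hA i d))
    simpa [hd, Matrix.mulVec, dotProduct] using this
  refine ⟨fun k => d - ∑ j, ((Q k)⁻¹.mulVec fun i => A k i d) j • v j, ?_, ?_⟩
  · have := tendsto_const_nhds (x := d).sub
      (tendsto_finsetSum Finset.univ fun j _ => (hc j).smul_const (v j))
    simpa using this
  · filter_upwards [hdetQ] with k hk i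
    have h1 : (Q k).mulVec ((Q k)⁻¹.mulVec fun i => A k i d) = fun i => A k i d := by
      rw [Matrix.mulVec_mulVec, Matrix.mul_nonsing_inv _ (isUnit_iff_ne_zero.2 hk),
        Matrix.one_mulVec]
    have h2 := congrFun h1 i
    simp only [Matrix.mulVec, dotProduct] at h2
    rw [map_sub, map_sum, sub_eq_zero, ← h2]
    refine Finset.sum_congr rfl fun j _ => ?_
    rw [map_smul, smul_eq_mul, mul_comm]
    rfl

section LPStability

variable {n : ℕ} {E I V : Type*} {M : Problem n E I V}

lemma aW_smooth (W : Set V) (i : E ⊕ W) : ContDiff ℝ 1 (aW M W i) := by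
  rcases i with i | i
  · exact M.h_smooth i
  · exact (M.H_smooth i).neg

lemma bW_smooth (W : Set V) (i : I ⊕ (↥Wᶜ ⊕ ↥Wᶜ)) : ContDiff ℝ 1 (bW M W i) := by
  rcases i with i | i | i
  · exact M.g_smooth i
  · exact (M.H_smooth i).neg
  · exact M.G_smooth i

lemma fderiv_neg_H (i : V) (x : Vec n) :
    fderiv ℝ (fun y => -M.H i y) x = -fderiv ℝ (M.H i) x := fderiv_fun_neg

/-- The constraints of the linear program in terms of the constraint functions of the system for
which the constraint qualification is imposed. -/
lemma lpFeasible_of_forall {x d : Vec n} {W : Set V}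
    (ha : ∀ i, fderiv ℝ (aW M W i) x d = 0)
    (hb : ∀ i, min 0 (bW M W i x) + fderiv ℝ (bW M W i) x d ≤ 0)
    (hbox : ∀ j, -1 ≤ d j ∧ d j ≤ 1) : LPFeasible M x W d := by
  refine ⟨fun i => ha (Sum.inl i), fun i => hb (Sum.inl i), fun i hi => ?_, fun i hi => ?_, hbox⟩
  · have := ha (Sum.inr ⟨i, hi⟩)
    change fderiv ℝ (fun y => -M.H i y) x d = 0 at this
    rw [fderiv_neg_H] at this
    exact this
  · have h1 := hb (Sum.inr (Sum.inl ⟨i, hi⟩))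
    have h2 := hb (Sum.inr (Sum.inr ⟨i, hi⟩))
    change min 0 (-M.H i x) + fderiv ℝ (fun y => -M.H i y) x d ≤ 0 at h1
    rw [fderiv_neg_H] at h1
    exact ⟨h1, h2⟩

/-- `W` is one of the sets between `I⁰⁺(x)` and `I⁰⁺(x) ∪ I⁰⁰(x)`. -/
def IsBetween (M : Problem n E I V) (x : Vec n) (W : Set V) : Prop :=
  I0plus M x ⊆ W ∧ W ⊆ I0plus M x ∪ I00 M x

lemma IsBetween.H_eq_zero {x : Vec n} {W : Set V} (hW : IsBetween M x W) {i : V} (hi : i ∈ W) :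
    M.H i x = 0 :=
  (hW.2 hi).elim (fun h => h.1) (fun h => h.1)

lemma IsBetween.F_mem_PW {x : Vec n} {W : Set V} (hW : IsBetween M x W) (hx : Feasible M x)
    (i : V) : F M i x ∈ PW W i := by
  by_cases hi : i ∈ W
  · rw [mem_PW_of_mem hi]
    simp [F, hW.H_eq_zero hi]
  · rw [mem_PW_of_notMem hi]
    obtain ⟨h1, h2⟩ := hx.2.2 i
    refine ⟨by simpa [F] using h1, ?_⟩
    by_contra! hG
    have hG : 0 < M.G i x := hG
    exact hi (hW.1 ⟨by nlinarith, hG⟩)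

lemma IsBetween.bW_nonpos {x : Vec n} {W : Set V} (hW : IsBetween M x W) (hx : Feasible M x)
    (i : I ⊕ (↥Wᶜ ⊕ ↥Wᶜ)) : bW M W i x ≤ 0 := by
  rcases i with i | i | i
  · exact hx.2.1 i
  · exact ((mem_PW_of_notMem i.2).1 (hW.F_mem_PW hx i)).1
  · exact ((mem_PW_of_notMem i.2).1 (hW.F_mem_PW hx i)).2

variable [Finite E] [Finite I] [Finite V]

/-- A strict linearized descent direction at `x` persists, after scaling and a small correction, as
a feasible direction of the linear programs at nearby points with a uniformly negative value. -/
lemma exists_lpFeasible_of_strict {x : Vec n} (hx : Feasible M x) {W : Set V}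
    (hW : IsBetween M x W) (hli : LinearIndependent ℝ fun i => fderiv ℝ (aW M W i) x) {d : Vec n}
    (ha : ∀ i, fderiv ℝ (aW M W i) x d = 0)
    (hb : ∀ i, bW M W i x = 0 → fderiv ℝ (bW M W i) x d < 0)
    (hf : fderiv ℝ M.f x d < 0) {κ : Type*} {l : Filter κ} {y : κ → Vec n}
    (hy : Tendsto y l (𝓝 x)) :
    ∃ η > 0, ∀ᶠ k in l, ∃ e, LPFeasible M (y k) W e ∧ fderiv ℝ M.f (y k) e ≤ -η := by
  -- scaling makes all inactive constraints and the box constraints strict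
  obtain ⟨τ, hτ0, hτb, hτbox⟩ : ∃ τ : ℝ, 0 < τ ∧
      (∀ i, min 0 (bW M W i x) + fderiv ℝ (bW M W i) x (τ • d) < 0) ∧
      ∀ j, -1 < (τ • d) j ∧ (τ • d) j < 1 := by
    have hev : ∀ c : Vec n → ℝ, Continuous c → Tendsto (fun τ : ℝ => c (τ • d)) (𝓝[>] 0)
        (𝓝 (c 0)) := fun c hc => by
      have h1 : Continuous fun τ : ℝ => c (τ • d) := by fun_prop
      simpa using (h1.tendsto 0).mono_left nhdsWithin_le_nhds
    have h1 : ∀ i, ∀ᶠ τ : ℝ in 𝓝[>] 0,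
        min 0 (bW M W i x) + fderiv ℝ (bW M W i) x (τ • d) < 0 := fun i => by
      rcases (hW.bW_nonpos hx i).lt_or_eq with hlt | heq
      · refine (hev (fun v => min 0 (bW M W i x) + fderiv ℝ (bW M W i) x v)
          (by fun_prop)).eventually (gt_mem_nhds ?_)
        simpa using hlt
      · filter_upwards [self_mem_nhdsWithin] with τ hτ
        rw [heq, min_self, zero_add, map_smul, smul_eq_mul]
        exact mul_neg_of_pos_of_neg hτ (hb i heq)
    have h2 : ∀ j, ∀ᶠ τ : ℝ in 𝓝[>] 0, -1 < (τ • d) j ∧ (τ • d) j < 1 := fun j => by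
      have := hev (fun v => v j) (by fun_prop)
      exact (this.eventually (lt_mem_nhds (by simp))).and
        (this.eventually (gt_mem_nhds (by simp)))
    have hpos : ∀ᶠ τ : ℝ in 𝓝[>] 0, 0 < τ := self_mem_nhdsWithin
    obtain ⟨τ, h0, h1, h2⟩ :=
      (hpos.and ((eventually_all.2 h1).and (eventually_all.2 h2))).exists
    exact ⟨τ, h0, h1, h2⟩
  obtain ⟨e, he, heq⟩ := exists_tendsto_forall_apply_eq_zero
    (A := fun k i => fderiv ℝ (aW M W i) (y k)) hli
    (fun i v => tendsto_fderiv_apply (aW_smooth W i) hy tendsto_const_nhds)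
    (d := τ • d) (fun i => by rw [map_smul, ha i, smul_zero])
  have hneg : fderiv ℝ M.f x (τ • d) < 0 := by
    rw [map_smul, smul_eq_mul]
    exact mul_neg_of_pos_of_neg hτ0 hf
  refine ⟨-(fderiv ℝ M.f x (τ • d) / 2), by linarith, ?_⟩
  have h1 : ∀ i, ∀ᶠ k in l, min 0 (bW M W i (y k)) + fderiv ℝ (bW M W i) (y k) (e k) < 0 :=
    fun i => (((tendsto_const_nhds (x := (0 : ℝ))).min
      (((bW_smooth W i).continuous.tendsto x).comp hy)).add
      (tendsto_fderiv_apply (bW_smooth W i) hy he)).eventually (gt_mem_nhds (hτb i))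
  have h2 : ∀ j, ∀ᶠ k in l, -1 < e k j ∧ e k j < 1 := fun j => by
    have hj : Tendsto (fun k => e k j) l (𝓝 ((τ • d) j)) :=
      ((PiLp.continuous_apply 2 (fun _ : Fin n => ℝ) j).tendsto _).comp he
    exact (hj.eventually (lt_mem_nhds (hτbox j).1)).and (hj.eventually (gt_mem_nhds (hτbox j).2))
  have h3 : ∀ᶠ k in l, fderiv ℝ M.f (y k) (e k) < fderiv ℝ M.f x (τ • d) / 2 :=
    (tendsto_fderiv_apply M.f_smooth hy he).eventually (gt_mem_nhds (by linarith))
  filter_upwards [heq, eventually_all.2 h1, eventually_all.2 h2, h3] with k k0 k1 k2 k3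
  exact ⟨e k, lpFeasible_of_forall k0 (fun i => (k1 i).le)
    (fun j => ⟨(k2 j).1.le, (k2 j).2.le⟩), by linarith⟩

end LPStability

/-! ### The correction step -/

section Correction

variable {n : ℕ} {E I V : Type*} [Fintype E] [Fintype I] [Fintype V] {M : Problem n E I V}

/-- Along a feasible direction of the linear program the linearized constraint violations do not
increase. -/
lemma LPFeasible.phiHatW_smul_le {σ : Pen E I V} (hσ : PenNonneg σ) {x d : Vec n} {W : Set V}
    (h : LPFeasible M x W d) {α : ℝ} (h0 : 0 ≤ α) (h1 : α ≤ 1) :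
    phiHatW M σ 0 W x (α • d) ≤ phiW M σ W x + α * fderiv ℝ M.f x d := by
  have key : ∀ a v : ℝ, min 0 a + v ≤ 0 → max 0 (a + α * v) ≤ max 0 a := fun a v hv => by
    rcases le_total 0 a with ha | ha
    · rw [min_eq_left ha] at hv
      exact max_le_max le_rfl (by nlinarith)
    · rw [min_eq_right ha] at hv
      exact max_le (le_max_left _ _) ((le_max_left 0 a).trans' (by nlinarith))
  have e1 : ∀ i, |M.h i x + fderiv ℝ (M.h i) x (α • d)| = |M.h i x| := fun i => by
    rw [map_smul, h.1 i, smul_zero, add_zero]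
  have e2 : ∑ i, σ.g i * max 0 (M.g i x + fderiv ℝ (M.g i) x (α • d))
      ≤ ∑ i, σ.g i * max 0 (M.g i x) :=
    Finset.sum_le_sum fun i _ => mul_le_mul_of_nonneg_left (by
      rw [map_smul, smul_eq_mul]; exact key _ _ (h.2.1 i)) (hσ.2.1 i)
  have e3 : ∑ i, σ.F i * dist1 (F M i x + dF M i x (α • d)) (PW W i)
      ≤ ∑ i, σ.F i * dist1 (F M i x) (PW W i) :=
    Finset.sum_le_sum fun i _ => mul_le_mul_of_nonneg_left (by
      have hsm : dF M i x (α • d) = α • dF M i x d := by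
        ext <;> simp [dF]
      rw [hsm]
      by_cases hi : i ∈ W
      · have hd : (dF M i x d).1 = 0 := h.2.2.1 i hi
        rw [dist1_PW_of_mem hi, dist1_PW_of_mem hi]
        simp [hd]
      · obtain ⟨hd1, hd2⟩ := h.2.2.2.1 i hi
        rw [dist1_PW_of_notMem hi, dist1_PW_of_notMem hi]
        exact add_le_add (key _ _ hd1) (key _ _ hd2)) (hσ.2.2 i)
  have e5 : bil (0 : Matrix (Fin n) (Fin n) ℝ) (α • d) (α • d) = 0 := by simp [bil]
  rw [phiHatW, phiW, e5, map_smul, smul_eq_mul]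
  simp only [e1]
  linarith

lemma IsBetween.phiW_eq_Phi {σ : Pen E I V} {x : Vec n} {W : Set V} (hW : IsBetween M x W)
    (hx : Feasible M x) : phiW M σ W x = Phi M σ x := by
  rw [phiW, Phi]
  congr 1
  refine Finset.sum_congr rfl fun i _ => ?_
  rw [dist1_PW_eq_zero (hW.F_mem_PW hx i),
    le_antisymm ((dist1_P_le_PW W i _).trans_eq (dist1_PW_eq_zero (hW.F_mem_PW hx i)))
      (dist1_P_nonneg _)]

lemma continuous_Phi (σ : Pen E I V) : Continuous (Phi M σ) := by
  have h1 := M.f_smooth.continuous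
  have h2 := fun i => (M.h_smooth i).continuous
  have h3 := fun i => (M.g_smooth i).continuous
  have h4 := fun i => continuous_dist1_P (M := M) i
  unfold Phi
  fun_prop

lemma continuous_phiW (σ : Pen E I V) (W : Set V) : Continuous (phiW M σ W) := by
  have h1 := M.f_smooth.continuous
  have h2 := fun i => (M.h_smooth i).continuous
  have h3 := fun i => (M.g_smooth i).continuous
  have h4 := fun i => continuous_dist1_PW (M := M) W i
  unfold phiW
  fun_prop

variable {A : Params} {T : Trace n E I V}

/-- At a limit point with correctly identified index sets neither of the two systems admits a strict
descent direction. Otherwise the linear programs keep uniformly negative values near the limit, the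
gap between `phiW` and `Phi` that triggers giving up tends to zero, and so the correction steps
decrease the merit function by a fixed amount infinitely often. -/
lemma IsInfiniteRun.not_exists_strict (hrun : IsInfiniteRun M A T)
    (hbdd : BoundednessAssumption T) {K : Set ℕ} [NeBot (atTop ⊓ 𝓟 K)] {x : Vec n}
    (hx : Tendsto T.x (atTop ⊓ 𝓟 K) (𝓝 x))
    (hK : ∀ k ∈ K, T.W1 k = I0plus M x ∧ T.W2 k = I0plus M x ∪ I00 M x)
    {W : Set V} (hW : W = I0plus M x ∨ W = I0plus M x ∪ I00 M x)
    (hli : LinearIndependent ℝ fun i => fderiv ℝ (aW M W i) x) (d : Vec n)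
    (ha : ∀ i, fderiv ℝ (aW M W i) x d = 0)
    (hb : ∀ i, bW M W i x = 0 → fderiv ℝ (bW M W i) x d < 0) :
    0 ≤ fderiv ℝ M.f x d := by
  by_contra! hf
  have hfeas := hrun.feasible_of_tendsto hbdd hx
  have hbet : ∀ W, W = I0plus M x ∨ W = I0plus M x ∪ I00 M x → IsBetween M x W := by
    rintro W (rfl | rfl)
    · exact ⟨subset_rfl, Set.subset_union_left⟩
    · exact ⟨Set.subset_union_left, subset_rfl⟩
  obtain ⟨η, hη, hLP⟩ := exists_lpFeasible_of_strict hfeas (hbet W hW) hli ha hb hf hx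
  obtain ⟨σ, hσ, hcorr, hdec, -⟩ := hrun.exists_limit_penalty hbdd
  obtain ⟨⟨Cx, Cs, Cl, hC⟩, -⟩ := hbdd
  obtain ⟨hμ0, hμ1⟩ := A.hμ
  have hμ1' : 0 < 1 - A.μ := sub_pos.2 hμ1
  have hαlo := A.hα.1
  set L : ℝ := √n + 1
  have hL : 0 < L := by positivity
  -- `b` is the upper end of the window of step sizes where the Taylor remainder is harmless
  set ε : ℝ := (1 - A.μ) * η / 2 / L with hε
  have hε0 : 0 < ε := by positivity
  obtain ⟨r, hr, hball⟩ := Metric.eventually_nhds_iff.1 (eventually_phiW_add_le M hσ Cx hε0)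
  set b : ℝ := min 1 (r / 2 / L) with hbdef
  have hb0 : 0 < b := by positivity
  set ε₂ : ℝ := min (A.αlo * b * ((1 - A.μ) * η / 2)) (A.αlo * b * (A.μ * η)) with hε₂
  have hε₂0 : 0 < ε₂ := by positivity
  have hgap : ∀ W, W = I0plus M x ∨ W = I0plus M x ∪ I00 M x →
      ∀ᶠ k in atTop ⊓ 𝓟 K, phiW M σ W (T.x k) - Phi M σ (T.x k) < ε₂ := fun W hW => by
    have hlim : Tendsto (fun k => phiW M σ W (T.x k) - Phi M σ (T.x k)) (atTop ⊓ 𝓟 K) (𝓝 0) := by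
      have := (((continuous_phiW (M := M) σ W).tendsto x).comp hx).sub
        (((continuous_Phi (M := M) σ).tendsto x).comp hx)
      simpa [(hbet W hW).phiW_eq_Phi hfeas] using this
    exact hlim.eventually (gt_mem_nhds hε₂0)
  have hdec' := hdec.eventually (gt_mem_nhds (show 0 < A.αlo * b * (A.μ * η) by positivity))
  have hfalse : ∀ᶠ k in atTop ⊓ 𝓟 K, False := by
    filter_upwards [hLP, hcorr.filter_mono inf_le_left, hdec'.filter_mono inf_le_left,
      hgap _ (Or.inl rfl), hgap _ (Or.inr rfl),
      (eventually_principal.2 fun k hk => hk : ∀ᶠ k in 𝓟 K, k ∈ K).filter_mono inf_le_right]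
      with k hLPk hσk hdeck hg1 hg2 hkK
    obtain ⟨hW1, hW2⟩ := hK k hkK
    obtain ⟨e, he, hfe⟩ := hLPk
    have hval : fderiv ℝ M.f (T.x k) (T.d k) ≤ -η := by
      have h12 : fderiv ℝ M.f (T.x k) (T.d1 k) ≤ -η ∨ fderiv ℝ M.f (T.x k) (T.d2 k) ≤ -η := by
        rcases hW with rfl | rfl
        · exact Or.inl (((hrun.d1_sol k).2 e (hW1 ▸ he)).trans hfe)
        · exact Or.inr (((hrun.d2_sol k).2 e (hW2 ▸ he)).trans hfe)
      rcases hrun.d_choice k with ⟨h1, -, h3⟩ | ⟨h1, -, h3⟩ <;> rw [h1] <;>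
        rcases h12 with h | h <;> linarith
    have hgk : phiW M σ (T.W k) (T.x k) - Phi M σ (T.x k) < ε₂ := by
      rcases hrun.d_choice k with ⟨-, h2, -⟩ | ⟨-, h2, -⟩ <;> rw [h2]
      · rwa [hW1]
      · rwa [hW2]
    have hfeask := hrun.lpFeasible_d k
    have htr := hrun.trialSeq_α k
    set D := fderiv ℝ M.f (T.x k) (T.d k) with hD
    obtain ⟨i, hi1, hi2⟩ := htr.exists_mem_window hb0 (min_le_left _ _)
    have hacc : CorrDecrease M A T k (T.α k i) := by
      unfold CorrDecrease
      rw [hσk, ← hD]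
      have hα0 := htr.pos i
      have hnorm : ‖T.α k i • T.d k‖ ≤ T.α k i * L := by
        rw [norm_smul, Real.norm_of_nonneg hα0.le]
        exact mul_le_mul_of_nonneg_left (hfeask.norm_le.trans (by simp [L])) hα0.le
      have hsmall : T.α k i * L ≤ r / 2 :=
        (le_div_iff₀ hL).1 (hi2.trans (min_le_right _ _))
      have h1 := hball (y := T.α k i • T.d k) (by rw [dist_zero_right]; linarith) (T.x k)
        (hC k).1 (T.W k)
      have h2 := hfeask.phiHatW_smul_le hσ hα0.le (htr.le_one i)
      have h3 := Phi_le_phiW (M := M) (W := T.W k) (x := T.x k + T.α k i • T.d k) hσ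
      have h4 : ε * ‖T.α k i • T.d k‖ ≤ T.α k i * ((1 - A.μ) * η / 2) := by
        refine (mul_le_mul_of_nonneg_left hnorm hε0.le).trans_eq ?_
        rw [hε]; field_simp
      have h5 : ε₂ ≤ T.α k i * ((1 - A.μ) * η / 2) :=
        (min_le_left _ _).trans (mul_le_mul_of_nonneg_right hi1 (by positivity))
      have h6 : T.α k i * (1 - A.μ) * D ≤ T.α k i * (1 - A.μ) * -η :=
        mul_le_mul_of_nonneg_left hval (by positivity)
      rw [← hD] at h2
      linarith
    obtain ⟨j, hj, hj1, -⟩ := hrun.correct k (by linarith)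
    have hαj : A.αlo * b ≤ T.α k j := hi1.trans (htr.antitone (hj.2 (Or.inl hacc)))
    by_cases hcd : CorrDecrease M A T k (T.α k j)
    · have hxt := hj1 hcd
      unfold CorrDecrease at hcd
      rw [hσk, ← hxt, ← hD] at hcd
      have h1 : A.μ * T.α k j * D ≤ A.μ * T.α k j * -η :=
        mul_le_mul_of_nonneg_left hval (mul_pos hμ0 (htr.pos j)).le
      have h2 : A.αlo * b * (A.μ * η) ≤ T.α k j * (A.μ * η) :=
        mul_le_mul_of_nonneg_right hαj (by positivity)
      linarith
    · have hgu := hj.1.resolve_left hcd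
      unfold CorrGiveUp at hgu
      rw [hσk, ← hD, le_div_iff_of_neg (mul_neg_of_pos_of_neg hμ0 (by linarith))] at hgu
      have h1 : T.α k j * (A.μ * D) ≤ T.α k j * (A.μ * -η) :=
        mul_le_mul_of_nonneg_left (mul_le_mul_of_nonneg_left hval hμ0.le) (htr.pos j).le
      have h2 : A.αlo * b * (A.μ * η) ≤ T.α k j * (A.μ * η) :=
        mul_le_mul_of_nonneg_right hαj (by positivity)
      linarith [min_le_right (A.αlo * b * ((1 - A.μ) * η / 2)) (A.αlo * b * (A.μ * η))]
  simpa using hfalse.exists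

end Correction

/-! ### Multipliers from the absence of strict descent directions -/

/-- Gordan's theorem: finitely many functionals without a common strict negativity direction admit
a vanishing convex combination. -/
lemma exists_convex_combination_eq_zero {X κ : Type*} [NormedAddCommGroup X]
    [InnerProductSpace ℝ X] [CompleteSpace X] [Fintype κ] (φ : κ → X →L[ℝ] ℝ)
    (h : ¬ ∃ d, ∀ i, φ i d < 0) :
    ∃ w : κ → ℝ, (∀ i, 0 ≤ w i) ∧ ∑ i, w i = 1 ∧ ∑ i, w i • φ i = 0 := by
  classical
  set J := InnerProductSpace.toDual ℝ X
  set Λ : (κ → ℝ) →ₗ[ℝ] X := Fintype.linearCombination ℝ fun i => J.symm (φ i)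
  have hΛ : Continuous Λ := LinearMap.continuous_of_finiteDimensional Λ
  by_cases h0 : (0 : X) ∈ Λ '' stdSimplex ℝ κ
  · obtain ⟨w, ⟨hw0, hw1⟩, hw⟩ := h0
    refine ⟨w, hw0, hw1, J.symm.injective ?_⟩
    rw [map_zero, ← hw, map_sum]
    simp [Λ, Fintype.linearCombination_apply]
  · exfalso
    have hcomp : IsCompact (Λ '' stdSimplex ℝ κ) := (isCompact_stdSimplex ℝ κ).image hΛ
    obtain ⟨q, u, hq0, hq⟩ := geometric_hahn_banach_point_closed
      ((convex_stdSimplex ℝ κ).linear_image Λ) hcomp.isClosed h0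
    rw [map_zero] at hq0
    refine h ⟨-J.symm q, fun i => ?_⟩
    have h1 := hq _ ⟨Pi.single i 1, single_mem_stdSimplex ℝ i, rfl⟩
    have h2 : Λ (Pi.single i 1) = J.symm (φ i) := by simp [Λ]
    have h3 : q (J.symm (φ i)) = φ i (J.symm q) := by
      rw [← InnerProductSpace.toDual_symm_apply, real_inner_comm,
        InnerProductSpace.toDual_symm_apply]
    rw [h2, h3] at h1
    rw [map_neg]
    linarith

/-- Under a constraint qualification of Mangasarian–Fromovitz type (the point `d₀`), the absence of
strict descent directions yields Lagrange multipliers: Gordan's theorem is applied on the common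
kernel of the equality constraints, and `d₀` forces the weight of `f` to be positive. -/
lemma exists_multipliers_of_no_strict {X ι κ : Type*} [NormedAddCommGroup X]
    [InnerProductSpace ℝ X] [FiniteDimensional ℝ X] [Fintype ι] [Fintype κ] (f : X →L[ℝ] ℝ)
    (a : ι → X →L[ℝ] ℝ) (b : κ → X →L[ℝ] ℝ) (S : Set κ) {d₀ : X} (ha₀ : ∀ i, a i d₀ = 0)
    (hb₀ : ∀ i ∈ S, b i d₀ < 0)
    (h : ∀ d, (∀ i, a i d = 0) → (∀ i ∈ S, b i d < 0) → 0 ≤ f d) :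
    ∃ (c : ι → ℝ) (w : κ → ℝ), (∀ i, 0 ≤ w i) ∧ (∀ i ∉ S, w i = 0) ∧
      f + ∑ i, c i • a i + ∑ i, w i • b i = 0 := by
  classical
  set L : Submodule ℝ X := ⨅ i, LinearMap.ker (a i : X →ₗ[ℝ] ℝ) with hL
  have hmem : ∀ d, d ∈ L ↔ ∀ i, a i d = 0 := fun d => by
    simp [hL, Submodule.mem_iInf]
  set φ : Option S → L →L[ℝ] ℝ := fun o => (o.elim f fun i => b i).comp L.subtypeL with hφ
  obtain ⟨w, hw0, hw1, hw⟩ := exists_convex_combination_eq_zero φ (by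
    rintro ⟨⟨d, hd⟩, hneg⟩
    have hf : f d < 0 := hneg none
    exact absurd (h d ((hmem d).1 hd) fun i hi => hneg (some ⟨i, hi⟩)) (not_le.2 hf))
  have hrel : ∀ d ∈ L, w none * f d + ∑ i : S, w (some i) * b i d = 0 := fun d hd => by
    have := congrArg (fun q : L →L[ℝ] ℝ => q ⟨d, hd⟩) hw
    simpa [hφ, Fintype.sum_option] using this
  have hpos : 0 < w none := by
    refine (hw0 none).lt_of_ne fun hz => ?_
    have h1 := hrel d₀ ((hmem d₀).2 ha₀)
    rw [← hz, zero_mul, zero_add] at h1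
    have hnp : ∀ i ∈ Finset.univ, w (some i) * b (i : S) d₀ ≤ 0 := fun i _ =>
      mul_nonpos_of_nonneg_of_nonpos (hw0 _) (hb₀ i i.2).le
    have h2 := (Finset.sum_eq_zero_iff_of_nonpos hnp).1 h1
    have h3 : ∀ i : S, w (some i) = 0 := fun i =>
      (mul_eq_zero.1 (h2 i (Finset.mem_univ i))).resolve_right (hb₀ i i.2).ne
    rw [Fintype.sum_option, ← hz, Finset.sum_eq_zero fun i _ => h3 i, add_zero] at hw1
    exact zero_ne_one hw1
  set v : κ → ℝ := fun i => if hi : i ∈ S then w (some ⟨i, hi⟩) / w none else 0 with hv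
  have hvS : ∀ d, ∑ i, v i * b i d = ∑ i : S, w (some i) / w none * b i d := fun d => by
    have h1 : ∑ i ∈ Finset.univ.filter (· ∈ S), v i * b i d = ∑ i, v i * b i d :=
      Finset.sum_filter_of_ne fun i _ hne => by
        by_contra hi
        exact hne (by simp [hv, hi])
    rw [← h1, Finset.sum_subtype (p := (· ∈ S)) _ (by simp)]
    refine Finset.sum_congr rfl fun i _ => ?_
    simp [hv, i.2]
  have hker : ∀ d ∈ L, f d + ∑ i, v i * b i d = 0 := fun d hd => by
    have h1 := congrArg (fun q => q / w none) (hrel d hd)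
    simp only [zero_div, add_div, mul_div_cancel_left₀ _ hpos.ne', Finset.sum_div] at h1
    rw [hvS, ← h1]
    congr 1
    exact Finset.sum_congr rfl fun i _ => by ring
  have hspan : ((f + ∑ i, v i • b i : X →L[ℝ] ℝ) : X →ₗ[ℝ] ℝ)
      ∈ Submodule.span ℝ (Set.range fun i => (a i : X →ₗ[ℝ] ℝ)) :=
    mem_span_of_iInf_ker_le_ker fun d hd => by
      simpa using hker d hd
  obtain ⟨c, hc⟩ := (Submodule.mem_span_range_iff_exists_fun ℝ).1 hspan
  refine ⟨fun i => -c i, v, fun i => ?_, fun i hi => by simp [hv, hi], ?_⟩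
  · simp only [hv]
    split_ifs
    · exact div_nonneg (hw0 _) hpos.le
    · exact le_rfl
  · ext d
    have h1 := LinearMap.congr_fun hc d
    simp at h1 ⊢
    linarith

section Stationarity

variable {n : ℕ} {E I V : Type*} {M : Problem n E I V}

open Classical in
/-- The multiplier of the vanishing constrained program obtained from multipliers `c` of the
equalities and `w` of the inequalities of the system given by `W`. -/
noncomputable def multOfSystem (W : Set V) (c : E ⊕ W → ℝ) (w : I ⊕ (↥Wᶜ ⊕ ↥Wᶜ) → ℝ) :
    Mult E I V where
  h := fun i => c (Sum.inl i)
  g := fun i => w (Sum.inl i)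
  H := fun i => if hi : i ∈ W then c (Sum.inr ⟨i, hi⟩) else w (Sum.inr (Sum.inl ⟨i, hi⟩))
  G := fun i => if hi : i ∈ W then 0 else w (Sum.inr (Sum.inr ⟨i, hi⟩))

lemma weakCond_multOfSystem {x : Vec n} {W : Set V} (hW : IsBetween M x W) {c : E ⊕ W → ℝ}
    {w : I ⊕ (↥Wᶜ ⊕ ↥Wᶜ) → ℝ} (hw : ∀ i, 0 ≤ w i) (hw0 : ∀ i, bW M W i x ≠ 0 → w i = 0) :
    WeakCond M x (multOfSystem W c w) := by
  have hcompl : ∀ i, w i * bW M W i x = 0 := fun i => by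
    by_cases h : bW M W i x = 0
    · rw [h, mul_zero]
    · rw [hw0 i h, zero_mul]
  refine ⟨fun i => hcompl (Sum.inl i), fun i => ?_, fun i => ?_, fun i => hw _, fun i hi => ?_,
    fun i hi => ?_⟩
  · by_cases hi : i ∈ W
    · rw [hW.H_eq_zero hi, mul_zero]
    · have h1 : w _ * -M.H i x = 0 := hcompl (Sum.inr (Sum.inl ⟨i, hi⟩))
      rw [mul_neg, neg_eq_zero] at h1
      simpa [multOfSystem, hi] using h1
  · by_cases hi : i ∈ W
    · simp [multOfSystem, hi]
    · have h1 : w _ * M.G i x = 0 := hcompl (Sum.inr (Sum.inr ⟨i, hi⟩))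
      simpa [multOfSystem, hi] using h1
  · have hiW : i ∉ W := fun h => by
      rcases hW.2 h with h' | h' <;> linarith [hi.2, h'.2]
    simpa [multOfSystem, hiW] using hw _
  · by_cases hiW : i ∈ W
    · simp [multOfSystem, hiW]
    · simpa [multOfSystem, hiW] using hw _

variable [Fintype E] [Fintype I] [Fintype V]

lemma statEq_multOfSystem {x : Vec n} {W : Set V} [Fintype W] [Fintype ↥Wᶜ] {c : E ⊕ W → ℝ}
    {w : I ⊕ (↥Wᶜ ⊕ ↥Wᶜ) → ℝ}
    (h : fderiv ℝ M.f x + ∑ i, c i • fderiv ℝ (aW M W i) x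
      + ∑ i, w i • fderiv ℝ (bW M W i) x = 0) : StatEq M x (multOfSystem W c w) := by
  classical
  unfold StatEq
  rw [← h, Fintype.sum_sum_type, Fintype.sum_sum_type, Fintype.sum_sum_type]
  have hsplit : ∀ q : V → Row n, ∑ i, q i = ∑ i : W, q i + ∑ i : ↥Wᶜ, q i := fun q => by
    rw [← Finset.sum_filter_add_sum_filter_not Finset.univ (· ∈ W),
      Finset.sum_subtype (p := (· ∈ W)) _ (by simp),
      Finset.sum_subtype (p := (· ∈ Wᶜ)) _ (by simp)]
  have hneg : ∀ i : V, fderiv ℝ (fun y => -M.H i y) x = -fderiv ℝ (M.H i) x :=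
    fun i => fderiv_neg_H i x
  have e1 : ∀ i : W, -((multOfSystem W c w).H i • fderiv ℝ (M.H i) x)
      + (multOfSystem W c w).G i • fderiv ℝ (M.G i) x
      = c (Sum.inr i) • fderiv ℝ (aW M W (Sum.inr i)) x := fun i => by
    simp [multOfSystem, aW, hneg]
  have e2 : ∀ i : ↥Wᶜ, -((multOfSystem W c w).H i • fderiv ℝ (M.H i) x)
      + (multOfSystem W c w).G i • fderiv ℝ (M.G i) x
      = w (Sum.inr (Sum.inl i)) • fderiv ℝ (bW M W (Sum.inr (Sum.inl i))) x
        + w (Sum.inr (Sum.inr i)) • fderiv ℝ (bW M W (Sum.inr (Sum.inr i))) x := fun i => by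
    have hi : (i : V) ∉ W := i.2
    simp [multOfSystem, bW, hneg, hi]
  rw [hsplit, Finset.sum_congr rfl fun i _ => e1 i, Finset.sum_congr rfl fun i _ => e2 i,
    Finset.sum_add_distrib]
  change _ + ∑ i, c (Sum.inl i) • fderiv ℝ (aW M W (Sum.inl i)) x
    + ∑ i, w (Sum.inl i) • fderiv ℝ (bW M W (Sum.inl i)) x + _ = _
  abel

/-- The multipliers attached to one of the two systems at the limit point. -/
lemma IsInfiniteRun.exists_weak_multiplier {A : Params} {T : Trace n E I V}
    (hrun : IsInfiniteRun M A T) (hbdd : BoundednessAssumption T) {K : Set ℕ}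
    [NeBot (atTop ⊓ 𝓟 K)] {x : Vec n} (hx : Tendsto T.x (atTop ⊓ 𝓟 K) (𝓝 x))
    (hK : ∀ k ∈ K, T.W1 k = I0plus M x ∧ T.W2 k = I0plus M x ∪ I00 M x)
    {W : Set V} (hW : W = I0plus M x ∨ W = I0plus M x ∪ I00 M x)
    (hmf : MFCQ (aW M W) (bW M W) x) :
    ∃ m : Mult E I V, StatEq M x m ∧ WeakCond M x m ∧
      (∀ i ∉ W, 0 ≤ m.H i ∧ 0 ≤ m.G i) ∧ ∀ i ∈ W, m.G i = 0 := by
  classical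
  obtain ⟨hli, d₀, ha₀, hb₀⟩ := hmf
  have hbet : IsBetween M x W := by
    rcases hW with rfl | rfl
    · exact ⟨subset_rfl, Set.subset_union_left⟩
    · exact ⟨Set.subset_union_left, subset_rfl⟩
  obtain ⟨c, w, hw, hw0, heq⟩ := exists_multipliers_of_no_strict (fderiv ℝ M.f x)
    (fun i => fderiv ℝ (aW M W i) x) (fun i => fderiv ℝ (bW M W i) x) {i | bW M W i x = 0}
    ha₀ hb₀ (fun d ha hb => hrun.not_exists_strict hbdd hx hK hW hli d ha hb)
  refine ⟨multOfSystem W c w, statEq_multOfSystem heq, weakCond_multOfSystem hbet hw hw0,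
    fun i hi => ?_, fun i hi => by simp [multOfSystem, hi]⟩
  simp [multOfSystem, hi, hw]

end Stationarity

end MPVC

theorem mainTheorem2 {n : ℕ} {E I V : Type*} [Fintype E] [Fintype I] [Fintype V]
    (M : MPVC.Problem n E I V) (A : MPVC.Params) (T : MPVC.Trace n E I V)
    (hrun : MPVC.IsInfiniteRun M A T)
    (hbdd : MPVC.BoundednessAssumption T)
    (xbar : MPVC.Vec n) (hlim : MapClusterPt xbar atTop T.x)
    (hxbar : MPVC.LimitPointAssumption M T xbar) :
    MPVC.QStationaryWrt M xbar ∅ (MPVC.I00 M xbar) ∧ MPVC.QMStationary M xbar := by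
  obtain ⟨hmf1, hmf2, K, hKinf, hx, hK⟩ := hxbar
  have : NeBot (atTop ⊓ 𝓟 K) :=
    frequently_mem_iff_neBot.1 (Nat.frequently_atTop_iff_infinite.2 hKinf)
  have hfeas := hrun.feasible_of_tendsto hbdd hx
  obtain ⟨up, hup1, hup2, hup3, -⟩ := hrun.exists_weak_multiplier hbdd hx hK (Or.inl rfl) hmf1
  obtain ⟨lo, hlo1, hlo2, -, hlo3⟩ := hrun.exists_weak_multiplier hbdd hx hK (Or.inr rfl) hmf2
  have hlo : ∀ i ∈ MPVC.I00 M xbar, lo.G i = 0 := fun i hi => hlo3 i (Or.inr hi)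
  have hpart : MPVC.IsPartitionI00 M xbar ∅ (MPVC.I00 M xbar) := by
    simp [MPVC.IsPartitionI00]
  have hpair : MPVC.IsQPair M xbar ∅ (MPVC.I00 M xbar) up lo := by
    refine ⟨hup1, hup2, hlo1, hlo2, fun i hi => hi.elim, fun i hi => ?_⟩
    have h := hup3 i fun h => h.2.ne' hi.2
    exact ⟨h.1, h.2, hlo i hi⟩
  -- the lower multiplier has `λᴳ = 0` on `I⁰⁰`, which is the additional M-stationarity condition
  exact ⟨⟨hfeas, hpart, up, lo, hpair⟩, hfeas, _, _, hpart, up, lo, hpair,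
    Or.inr fun i hi => by rw [hlo i hi, mul_zero]⟩
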